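/- All digraphs are finite and have no loops. A digraph $D=(V,A)$ is \emph{semicomplete multipartite} with \emph{partite sets} $V_1,\dots,V_c$ (a partition of $V$) if no arc has both ends in the same $V_i$ and there is at least one arc between any two vertices of different partite sets. It is \emph{extended semicomplete} if, moreover, for all $i\ne j$ one of the following holds: all arcs from $V_i$ to $V_j$ and none from $V_j$ to $V_i$ are present; all arcs from $V_j$ to $V_i$ and none from $V_i$ to $V_j$ are present; or all arcs between $V_i$ and $V_j$, in both directions, are present. (The partite sets are determined by $D$.) $D$ is \emph{strong} if for all $x,y\in V$ there is a directed path from $x$ to $y$. A \emph{G-cycle} of a semicomplete multipartite digraph $D$ is a cyclic sequence $v_1v_2\cdots v_kv_1$ ($k\ge1$) of distinct vertices such that for every $i$ (with $v_{k+1}=v_1$) either $v_iv_{i+1}\in A$ or $v_i$ and $v_{i+1}$ lie in the same partite set. Equivalently, it is either a directed cycle of $D$ or a cyclically ordered collection of $r\ge 1$ vertex-disjoint directed paths of $D$ (single vertices allowed) such that the end of each path and the start of the next one (after the last, the first) lie in the same partite set. Its number of arcs is the number of $i$ with $v_iv_{i+1}\in A$. It is \emph{spanning} if it contains all vertices of $D$.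 \textbf{Theorem.} There is a polynomial algorithm which, given a strong extended semicomplete digraph $D$ (by its adjacency matrix), decides whether $D$ has a spanning G-cycle and, if so, outputs a spanning G-cycle of $D$ that has the maximum number of arcs among all spanning G-cycles of $D$. That is, there are one program of a random access machine (with addition and truncated subtraction as its arithmetic operations, each operation, memory access and test costing one step) and one polynomial $p$ such that on every strong extended semicomplete digraph $D$ on $n$ vertices the program halts after at most $p(n)$ steps with the correct answer and, if the answer is yes, with such a G-cycle in its memory. -/

import Mathlib

/-! ### Semicomplete multipartite digraphs

Digraphs are Mathlib's `Digraph V`; the partition of the vertex set into partite sets is given by an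
equivalence relation `P : Setoid V`, whose classes are the partite sets. -/

/-- `D` is strong: every vertex can be reached from every vertex by a directed path. -/
def Digraph.IsStrong {V : Type*} (D : Digraph V) : Prop :=
  ∀ x y : V, Relation.ReflTransGen D.Adj x y

/-- `X → Y`: for all adjacent `x ∈ X`, `y ∈ Y` there is an arc from `x` to `y`. -/
def Digraph.SetDominates {V : Type*} (D : Digraph V) (X Y : Set V) : Prop :=
  ∀ x ∈ X, ∀ y ∈ Y, (D.Adj x y ∨ D.Adj y x) → D.Adj x y

/-- `X ⇒ Y`: `X → Y` and there is no arc from `Y` to `X`. -/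
def Digraph.SetStrictlyDominates {V : Type*} (D : Digraph V) (X Y : Set V) : Prop :=
  D.SetDominates X Y ∧ ∀ x ∈ X, ∀ y ∈ Y, ¬ D.Adj y x

/-- `D` is semicomplete multipartite, its partite sets being the classes of `P`: there is no arc
(in particular no loop) inside a partite set, and there is at least one arc between any two vertices
of different partite sets. -/
structure Digraph.IsSemicompleteMultipartite {V : Type*} (D : Digraph V) (P : Setoid V) :
    Prop where
  no_arc_inside : ∀ u v : V, P u v → ¬ D.Adj u v
  arc_between : ∀ u v : V, ¬ P u v → D.Adj u v ∨ D.Adj v u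

/-- `D` is extended semicomplete, its partite sets being the classes of `P`: it is semicomplete
multipartite and for any two different partite sets `X`, `Y` either `X ⇒ Y`, or `Y ⇒ X`, or `X ∪ Y`
induces a complete bipartite digraph (all arcs in both directions). -/
structure Digraph.IsExtendedSemicomplete {V : Type*} (D : Digraph V) (P : Setoid V) : Prop
    extends D.IsSemicompleteMultipartite P where
  between_classes : ∀ X ∈ P.classes, ∀ Y ∈ P.classes, X ≠ Y →
    D.SetStrictlyDominates X Y ∨ D.SetStrictlyDominates Y X ∨
      ∀ x ∈ X, ∀ y ∈ Y, D.Adj x y ∧ D.Adj y x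

/-! ### Generalized cycles

A G-cycle is written as the cyclic sequence of its vertices `v₁ v₂ ⋯ vₖ v₁`. Its arcs are the
consecutive pairs that are arcs of `D`; at every other consecutive pair a path of the G-cycle ends in
`vᵢ` and the next path starts in `vᵢ₊₁`, so that `vᵢ` and `vᵢ₊₁` must lie in the same partite set. If
every consecutive pair is an arc, the G-cycle is a directed cycle of `D`. A single vertex is a G-cycle
of length `0`. -/

/-- The pairs `(vᵢ, vᵢ₊₁)`, with `vₖ₊₁ = v₁`, of consecutive vertices of the cyclic sequence
`c = [v₁, …, vₖ]`. -/
def cyclicPairs {V : Type*} (c : List V) : List (V × V) :=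
  c.zip (c.rotate 1)

/-- `c` lists the vertices of a G-cycle of `D` in cyclic order. -/
structure Digraph.IsGCycle {V : Type*} (D : Digraph V) (P : Setoid V) (c : List V) : Prop where
  ne_nil : c ≠ []
  nodup : c.Nodup
  arc_or_same : ∀ p ∈ cyclicPairs c, D.Adj p.1 p.2 ∨ P p.1 p.2

/-- A spanning G-cycle: one that contains all vertices. -/
def Digraph.IsSpanningGCycle {V : Type*} (D : Digraph V) (P : Setoid V) (c : List V) : Prop :=
  D.IsGCycle P c ∧ ∀ v : V, v ∈ c

open Classical in
/-- The length of a G-cycle: its number of arcs of `D`. -/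
noncomputable def Digraph.gLength {V : Type*} (D : Digraph V) (c : List V) : ℕ :=
  (cyclicPairs c).countP (fun p => decide (D.Adj p.1 p.2))

/-! ### Random access machines

A random access machine with structured control flow. The memory consists of arrays, numbered by
natural numbers, of registers, each of which holds a natural number; a program refers to finitely
many arrays. The only arithmetic operations are addition and truncated subtraction, and every
operation, memory access and test costs one step. Hence in `t` steps the bit lengths of the numbers
in the memory grow by `O(t)` only, and Turing machines simulate this machine with polynomial
overhead, and conversely: its polynomial time is the usual one. -/

namespace RAM

/-- `σ a i` is the content of register number `i` of the array number `a`. -/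
abbrev Store : Type := ℕ → ℕ → ℕ

/-- Write `v` to register `i` of the array `a`. -/
def Store.write (σ : Store) (a i v : ℕ) : Store :=
  Function.update σ a (Function.update (σ a) i v)

inductive Expr : Type
  /-- a constant -/
  | const (k : ℕ)
  /-- the content of register `i` of the array `a` -/
  | read (a : ℕ) (i : Expr)
  | add (e₁ e₂ : Expr)
  /-- truncated subtraction -/
  | sub (e₁ e₂ : Expr)

def Expr.eval (σ : Store) : Expr → ℕ
  | .const k => k
  | .read a i => σ a (i.eval σ)
  | .add e₁ e₂ => e₁.eval σ + e₂.eval σ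
  | .sub e₁ e₂ => e₁.eval σ - e₂.eval σ

/-- The number of steps that the evaluation of an expression takes. -/
def Expr.cost : Expr → ℕ
  | .const _ => 1
  | .read _ i => i.cost + 1
  | .add e₁ e₂ => e₁.cost + e₂.cost + 1
  | .sub e₁ e₂ => e₁.cost + e₂.cost + 1

inductive Prog : Type
  | skip
  /-- write the value of `e` to register `i` of the array `a` -/
  | assign (a : ℕ) (i e : Expr)
  | seq (p q : Prog)
  /-- run `p` if `e` is not zero, otherwise `q` -/
  | ite (e : Expr) (p q : Prog)
  /-- run `p` as long as `e` is not zero -/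
  | while (e : Expr) (p : Prog)

/-- `Runs p σ τ t`: started with memory `σ`, the program `p` halts after exactly `t` steps with
memory `τ`. -/
inductive Runs : Prog → Store → Store → ℕ → Prop
  | skip (σ : Store) : Runs .skip σ σ 1
  | assign (a : ℕ) (i e : Expr) (σ : Store) :
      Runs (.assign a i e) σ (σ.write a (i.eval σ) (e.eval σ)) (i.cost + e.cost + 1)
  | seq {p q : Prog} {σ τ υ : Store} {s t : ℕ} (hp : Runs p σ τ s) (hq : Runs q τ υ t) :
      Runs (.seq p q) σ υ (s + t)
  | ite_true {e : Expr} {p q : Prog} {σ τ : Store} {t : ℕ} (he : e.eval σ ≠ 0)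
      (hp : Runs p σ τ t) : Runs (.ite e p q) σ τ (e.cost + 1 + t)
  | ite_false {e : Expr} {p q : Prog} {σ τ : Store} {t : ℕ} (he : e.eval σ = 0)
      (hq : Runs q σ τ t) : Runs (.ite e p q) σ τ (e.cost + 1 + t)
  | while_true {e : Expr} {p : Prog} {σ τ υ : Store} {s t : ℕ} (he : e.eval σ ≠ 0)
      (hp : Runs p σ τ s) (hw : Runs (.while e p) τ υ t) :
      Runs (.while e p) σ υ (e.cost + 1 + s + t)
  | while_false {e : Expr} {p : Prog} {σ : Store} (he : e.eval σ = 0) :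
      Runs (.while e p) σ σ (e.cost + 1)

open Classical in
/-- The initial memory on a digraph with vertex set `{0, …, n - 1}`: register `0` of array `0` holds
`n`, array `1` holds the adjacency matrix, row by row (entry `(i, j)` in register `i * n + j`), and
all other registers hold `0`. -/
noncomputable def inputDigraph {n : ℕ} (D : Digraph (Fin n)) : Store := fun a k =>
  if a = 0 ∧ k = 0 then n
  else if a = 1 ∧ ∃ i j : Fin n, k = i.val * n + j.val ∧ D.Adj i j then 1
  else 0

/-- The yes/no answer in the final memory is in register `0` of array `2` (`1` is yes, `0` is no). -/
def answer (τ : Store) : ℕ := τ 2 0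

/-- Array `3` of the final memory holds, from register `0` on, the sequence `c` of vertices. -/
def OutputsList {n : ℕ} (τ : Store) (c : List (Fin n)) : Prop :=
  ∀ i : Fin c.length, τ 3 i.val = (c.get i).val

end RAM

/-!
A spanning G-cycle is a permutation `π` of the vertices that has only one cycle and in which every
step `v → π v` is an arc or stays inside a partite set; its length is the number of steps that are
arcs. Dropping the condition on the number of cycles does not change the maximum, and this is what
makes the problem easy: maximizing the number of arcs over all permutations with allowed steps is an
assignment problem, and the cycles of an optimal permutation can be merged without loss. As the
identity has allowed steps only, every nonempty strong extended semicomplete digraph has a spanning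
G-cycle.

*Merging* (`Digraph.IsExtendedSemicomplete.exists_exchange`). Let `C` be the cycle of the vertex `0`
and suppose that it does not contain all vertices. If a vertex of `C` and a vertex outside `C` are in
the same partite set, they have the same neighbours, and exchanging their successors merges two cycles
and keeps all weights. Otherwise every vertex of `C` is joined by arcs to every vertex outside. If
there are arcs in both directions between `C` and some cycle `C'`, then either two successors can be
exchanged, or the arcs are invariant under one step forward on `C` together with one step backward on
`C'`; in this case cutting `C` at two places, and `C'` on both sides of a vertex, gives an exchange of
four successors in which all new steps are arcs (`exists_exchange_of_arcs_both_ways`). If no cycle has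
arcs from and to `C`, strong connectivity yields cycles `C'` and `C''` with all arcs from `C` to `C'`,
an arc from `C'` to `C''`, and all arcs from `C''` to `C`, and an exchange of three successors merges
the three cycles. So it suffices to try all exchanges on four vertices, `n` times.

*Optimizing.* The assignment problem is solved by an auction with integral prices that rise in steps
of `1` (`AuctionInv`). Its result is at most `n` below the optimum, which is enough because the weight
`(n + 1)² + (n + 1)` of an arc, the weight `(n + 1)²` of a pair inside a partite set and the weight
`0` of a forbidden step are multiples of `n + 1` (`RAM.card_le_of_sum_weight`,
`RAM.adj_or_rel_of_sum_weight`).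

*The machine.* The program is written in a language `RAM.Cmd` whose only loops are counting loops with
bounds `n + k`. Its semantics `RAM.Cmd.exec` is a total function on memories, and
`RAM.Cmd.runs_compile` translates it to the machine with a polynomial bound on the number of steps
that is read off the program text; what remains is to compute `exec`, with `exec_apply_of_writes` as
frame rule and `exec_loop_induction` as rule for loop invariants.
-/

/-! ### Exchanges in permutations -/

namespace Equiv.Perm

variable {V : Type*} {π ρ : Perm V}

/-- The successor function of the `4`-exchange on `a`, `b`, `c`, `d`: if these are distinct, their
successors become those of `b`, `c`, `d`, `a`. Shorter exchanges arise when the last arguments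
coincide. -/
def exchange [DecidableEq V] (π : Perm V) (a b c d : V) : Perm V :=
  π * swap a b * swap b c * swap c d

theorem exchange_two [DecidableEq V] (π : Perm V) (a b : V) : π.exchange a b b b = π * swap a b :=
  Equiv.ext fun x => by simp [exchange, swap_self]

theorem exchange_three [DecidableEq V] (π : Perm V) (a b c : V) :
    π.exchange a b c c = π * swap a b * swap b c :=
  Equiv.ext fun x => by simp [exchange, swap_self]

/-- Follow the `π`-cycle of `a` from `π a` to `b`: if `ρ` agrees with `π` on this cycle outside `a`
and `b`, the whole walk stays in one cycle of `ρ`. -/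
theorem SameCycle.of_eqOn_path [Finite V] {a b : V} (hab : π.SameCycle a b)
    (h : ∀ z, π.SameCycle a z → z ≠ a → z ≠ b → ρ z = π z) : ρ.SameCycle (π a) b := by
  classical
  have hex : ∃ k : ℕ, (π ^ k) (π a) = b := by
    obtain ⟨k, hk⟩ := (sameCycle_apply_left.2 hab).exists_nat_pow_eq
    exact ⟨k, hk⟩
  have hmin := fun j => Nat.find_min hex (m := j)
  have hspec := Nat.find_spec hex
  set k := Nat.find hex
  have ha : ∀ j < k, (π ^ j) (π a) ≠ a := by
    intro j hj hja
    refine hmin (k - j - 1) (by omega) ?_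
    rw [← hspec, show k = (k - j - 1) + 1 + j by omega, pow_add, mul_apply, hja, pow_succ,
      mul_apply]
    congr 3
    omega
  have key : ∀ j ≤ k, ρ.SameCycle (π a) ((π ^ j) (π a)) := by
    intro j
    induction j with
    | zero => intro _; exact SameCycle.refl _ _
    | succ j ih =>
      intro hj
      have hcyc : π.SameCycle a ((π ^ j) (π a)) :=
        sameCycle_pow_right.2 (sameCycle_apply_right.2 (SameCycle.refl _ _))
      rw [pow_succ', mul_apply, ← h _ hcyc (ha j hj) (hmin j hj)]
      exact sameCycle_apply_right.2 (ih (by omega))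
  simpa [hspec] using key k le_rfl

/-- The minimal period of a point is the number of points of its cycle. -/
theorem minimalPeriod_eq_ncard [Finite V] (π : Perm V) (x : V) :
    Function.minimalPeriod π x = {y | π.SameCycle x y}.ncard := by
  have hpos : 0 < Function.minimalPeriod π x := by
    refine Function.IsPeriodicPt.minimalPeriod_pos (isOfFinOrder_of_finite π).orderOf_pos ?_
    rw [Function.IsPeriodicPt, Function.IsFixedPt, iterate_eq_pow, pow_orderOf_eq_one]
    rfl
  have himage : {y | π.SameCycle x y} =
      (fun k => (π^[k]) x) '' Set.Iio (Function.minimalPeriod π x) := by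
    ext y
    constructor
    · intro hy
      obtain ⟨k, hk⟩ := SameCycle.exists_nat_pow_eq hy
      refine ⟨k % Function.minimalPeriod π x, Nat.mod_lt _ hpos, ?_⟩
      simpa [Function.iterate_mod_minimalPeriod_eq, iterate_eq_pow] using hk
    · rintro ⟨k, -, rfl⟩
      simp [iterate_eq_pow, sameCycle_pow_right, SameCycle.refl]
  rw [himage, Function.iterate_injOn_Iio_minimalPeriod.ncard_image]
  simp [← Finset.coe_Iio, Set.ncard_coe_finset]

theorem sameCycle_of_apply_eq {x y : V} (h : ρ x = y) : ρ.SameCycle x y :=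
  h ▸ sameCycle_apply_right.2 (SameCycle.refl _ _)

/-- If every step of the `π`-cycle of `o` stays in a cycle of `ρ`, and the `ρ`-cycle that contains it
meets another `π`-cycle, then the cycle of `o` is longer in `ρ` than in `π`. -/
theorem minimalPeriod_lt_of_sameCycle [Finite V] {o u y : V}
    (h : ∀ x, π.SameCycle o x → ρ.SameCycle x (π x)) (hu : π.SameCycle o u)
    (huy : ρ.SameCycle u y) (hy : ¬ π.SameCycle o y) :
    Function.minimalPeriod π o < Function.minimalPeriod ρ o := by
  have hsub : {x | π.SameCycle o x} ⊆ {x | ρ.SameCycle o x} := by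
    intro x hx
    obtain ⟨k, rfl⟩ := SameCycle.exists_nat_pow_eq hx
    have key : ∀ k : ℕ, ρ.SameCycle o ((π ^ k) o) := by
      intro k
      induction k with
      | zero => exact SameCycle.refl _ _
      | succ k ih =>
        rw [pow_succ', mul_apply]
        exact ih.trans (h _ (sameCycle_pow_right.2 (SameCycle.refl _ _)))
    exact key k
  rw [minimalPeriod_eq_ncard, minimalPeriod_eq_ncard]
  exact Set.ncard_lt_ncard ⟨hsub, fun hsub' => hy (hsub' ((hsub hu).trans huy))⟩ (Set.toFinite _)

variable [Finite V] {o a b c d : V}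

/-- A `2`-exchange that merges two cycles. -/
theorem minimalPeriod_lt_of_exchange_two (ha : π.SameCycle o a) (hb : ¬ π.SameCycle o b)
    (hρa : ρ a = π b) (hρb : ρ b = π a) (hρ : ∀ x, x ≠ a → x ≠ b → ρ x = π x) :
    Function.minimalPeriod π o < Function.minimalPeriod ρ o := by
  have hbb : ρ.SameCycle (π b) b := by
    refine SameCycle.of_eqOn_path (SameCycle.refl _ _) fun z hz hzb _ => hρ z ?_ hzb
    rintro rfl
    exact hb (ha.trans hz.symm)
  have hab : ρ.SameCycle a b := (sameCycle_of_apply_eq hρa).trans hbb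
  refine minimalPeriod_lt_of_sameCycle (fun x hx => ?_) ha hab hb
  by_cases hxa : x = a
  · subst hxa
    exact hab.trans (sameCycle_of_apply_eq hρb)
  · exact sameCycle_of_apply_eq (hρ x hxa fun e => hb (e ▸ hx))

/-- A `3`-exchange that merges three cycles. -/
theorem minimalPeriod_lt_of_exchange_three (ha : π.SameCycle o a) (hb : ¬ π.SameCycle o b)
    (hc : ¬ π.SameCycle o c) (hbc : ¬ π.SameCycle b c)
    (hρa : ρ a = π b) (hρb : ρ b = π c) (hρc : ρ c = π a)
    (hρ : ∀ x, x ≠ a → x ≠ b → x ≠ c → ρ x = π x) :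
    Function.minimalPeriod π o < Function.minimalPeriod ρ o := by
  have hbb : ρ.SameCycle (π b) b := by
    refine SameCycle.of_eqOn_path (SameCycle.refl _ _) fun z hz hzb _ => hρ z ?_ hzb ?_
    · rintro rfl
      exact hb (ha.trans hz.symm)
    · rintro rfl
      exact hbc hz
  have hcc : ρ.SameCycle (π c) c := by
    refine SameCycle.of_eqOn_path (SameCycle.refl _ _) fun z hz hzc _ => hρ z ?_ ?_ hzc
    · rintro rfl
      exact hc (ha.trans hz.symm)
    · rintro rfl
      exact hbc hz.symm
  have hab : ρ.SameCycle a b := (sameCycle_of_apply_eq hρa).trans hbb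
  refine minimalPeriod_lt_of_sameCycle (fun x hx => ?_) ha hab hb
  by_cases hxa : x = a
  · subst hxa
    exact ((hab.trans (sameCycle_of_apply_eq hρb)).trans hcc).trans (sameCycle_of_apply_eq hρc)
  · exact sameCycle_of_apply_eq (hρ x hxa (fun e => hb (e ▸ hx)) fun e => hc (e ▸ hx))

/-- A `4`-exchange that merges two cycles: the first is cut at `a` and `c`, the second at `b` and at
its successor. -/
theorem minimalPeriod_lt_of_exchange_four (ha : π.SameCycle o a) (hc : π.SameCycle o c)
    (hb : ¬ π.SameCycle o b) (hac : a ≠ c)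
    (hρa : ρ a = π b) (hρb : ρ b = π c) (hρc : ρ c = π (π b)) (hρd : ρ (π b) = π a)
    (hρ : ∀ x, x ≠ a → x ≠ b → x ≠ c → x ≠ π b → ρ x = π x) :
    Function.minimalPeriod π o < Function.minimalPeriod ρ o := by
  have hd : ¬ π.SameCycle o (π b) := fun h => hb (sameCycle_apply_right.1 h)
  have hdb : ρ.SameCycle (π (π b)) b := by
    refine SameCycle.of_eqOn_path (sameCycle_apply_left.2 (SameCycle.refl _ _))
      fun z hz hzd hzb => hρ z ?_ hzb ?_ hzd
    · rintro rfl
      exact hd (ha.trans hz.symm)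
    · rintro rfl
      exact hd (hc.trans hz.symm)
  have had : ρ.SameCycle a (π b) := sameCycle_of_apply_eq hρa
  refine minimalPeriod_lt_of_sameCycle (fun x hx => ?_) ha had hd
  by_cases hxa : x = a
  · subst hxa
    exact had.trans (sameCycle_of_apply_eq hρd)
  by_cases hxc : x = c
  · subst hxc
    exact ((sameCycle_of_apply_eq hρc).trans hdb).trans (sameCycle_of_apply_eq hρb)
  · exact sameCycle_of_apply_eq
      (hρ x hxa (fun e => hb (e ▸ hx)) hxc fun e => hd (e ▸ hx))

/-- A property that changes its truth value on a cycle does so, from true to false, at some step. -/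
theorem SameCycle.exists_step {p : V → Prop} {x y : V} (hxy : π.SameCycle x y) (hx : p x)
    (hy : ¬ p y) : ∃ z, π.SameCycle x z ∧ p z ∧ ¬ p (π z) := by
  obtain ⟨k, rfl⟩ := SameCycle.exists_nat_pow_eq hxy
  by_contra! hcon
  refine hy ?_
  clear hy hxy
  induction k with
  | zero => exact hx
  | succ k ih =>
    rw [pow_succ', mul_apply]
    exact hcon _ (sameCycle_pow_right.2 (SameCycle.refl _ _)) ih

/-- A set that a permutation of finite order maps into itself is mapped onto itself. -/
theorem iff_of_forall_imp {p : V → Prop} (h : ∀ x, p x → p (π x)) (x : V) :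
    p (π x) ↔ p x := by
  refine ⟨fun hx => ?_, h x⟩
  have key : ∀ k : ℕ, p ((π ^ k) (π x)) := by
    intro k
    induction k with
    | zero => exact hx
    | succ k ih => rw [pow_succ', mul_apply]; exact h _ ih
  obtain ⟨k, hk⟩ := (sameCycle_apply_left.2 (SameCycle.refl π x)).exists_nat_pow_eq
  exact hk ▸ key k

end Equiv.Perm

/-! ### Merging the cycles of a cycle factor -/

theorem Relation.ReflTransGen.exists_exit {V : Type*} {r : V → V → Prop} {p : V → Prop} {x y : V}
    (h : Relation.ReflTransGen r x y) (hx : p x) (hy : ¬ p y) : ∃ a b, r a b ∧ p a ∧ ¬ p b := by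
  induction h with
  | refl => exact absurd hx hy
  | @tail b c _ hbc ih =>
    by_cases hb : p b
    · exact ⟨b, c, hbc, hb, hy⟩
    · exact ih hb

namespace Digraph.IsExtendedSemicomplete

variable {V : Type*} {D : Digraph V} {P : Setoid V}

theorem rel_iff (hD : D.IsExtendedSemicomplete P) {u v : V} :
    P u v ↔ ¬ D.Adj u v ∧ ¬ D.Adj v u := by
  refine ⟨fun h => ⟨hD.no_arc_inside u v h, hD.no_arc_inside v u (P.symm' h)⟩, fun h => ?_⟩
  by_contra hP
  exact (hD.arc_between u v hP).elim h.1 h.2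

/-- Two vertices of a partite set have the same out-neighbours and the same in-neighbours. -/
theorem adj_of_rel (hD : D.IsExtendedSemicomplete P) {u v w : V} (h : P u v) :
    (D.Adj u w → D.Adj v w) ∧ (D.Adj w u → D.Adj w v) := by
  by_cases huw : P u w
  · exact ⟨fun ha => absurd ha (hD.no_arc_inside _ _ huw),
      fun ha => absurd ha (hD.no_arc_inside _ _ (P.symm' huw))⟩
  have hvw : ¬ P v w := fun h' => huw (P.trans' h h')
  have hne : {x | P x u} ≠ {x | P x w} := by
    intro he
    have : u ∈ {x | P x w} := he ▸ (P.refl' u : P u u)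
    exact huw this
  have hu : u ∈ {x | P x u} := P.refl' u
  have hv : v ∈ {x | P x u} := P.symm' h
  have hw : w ∈ {x | P x w} := P.refl' w
  rcases hD.between_classes _ (P.mem_classes u) _ (P.mem_classes w) hne with h1 | h1 | h1
  · exact ⟨fun _ => h1.1 v hv w hw (hD.arc_between _ _ hvw), fun ha => absurd ha (h1.2 u hu w hw)⟩
  · exact ⟨fun ha => absurd ha (h1.2 w hw u hu),
      fun _ => h1.1 w hw v hv (hD.arc_between _ _ hvw).symm⟩
  · exact ⟨fun _ => (h1 v hv w hw).1, fun _ => (h1 v hv w hw).2⟩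

theorem adj_left_iff (hD : D.IsExtendedSemicomplete P) {u v : V} (w : V) (h : P u v) :
    D.Adj u w ↔ D.Adj v w :=
  ⟨(hD.adj_of_rel h).1, (hD.adj_of_rel (P.symm' h)).1⟩

theorem adj_right_iff (hD : D.IsExtendedSemicomplete P) {u v : V} (w : V) (h : P u v) :
    D.Adj w u ↔ D.Adj w v :=
  ⟨(hD.adj_of_rel h).2, (hD.adj_of_rel (P.symm' h)).2⟩

open Equiv Equiv.Perm

variable [DecidableEq V] [Fintype V] {π : Perm V} {o : V}

/-- If there are arcs in both directions between the cycle of `o` and another cycle, then some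
exchange whose new steps are arcs merges the two cycles. -/
theorem exists_exchange_of_arcs_both_ways {u₁ u₂ y₁ y₂ : V}
    (hadj : ∀ u y, π.SameCycle o u → ¬ π.SameCycle o y → D.Adj u y ∨ D.Adj y u)
    (hu₁ : π.SameCycle o u₁) (hu₂ : π.SameCycle o u₂) (hy : ¬ π.SameCycle o y₁)
    (hyy : π.SameCycle y₁ y₂) (h₁ : D.Adj u₁ y₁) (h₂ : D.Adj y₂ u₂) :
    ∃ a b c d, (∀ x, π.exchange a b c d x = π x ∨ D.Adj x (π.exchange a b c d x)) ∧
      Function.minimalPeriod π o < Function.minimalPeriod (π.exchange a b c d) o := by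
  by_cases hswap : ∃ u y, π.SameCycle o u ∧ π.SameCycle y₁ y ∧ D.Adj u (π y) ∧ D.Adj y (π u)
  · obtain ⟨u, y, hu, hy', h1, h2⟩ := hswap
    have hoy : ¬ π.SameCycle o y := fun h => hy (h.trans hy'.symm)
    have huy : u ≠ y := fun e => hoy (e ▸ hu)
    refine ⟨u, y, y, y, fun x => ?_, ?_⟩ <;> rw [exchange_two]
    · by_cases hxu : x = u
      · subst hxu; right; simpa using h1
      by_cases hxy : x = y
      · subst hxy; right; simpa using h2
      · left; rw [mul_apply, swap_apply_of_ne_of_ne hxu hxy]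
    · refine minimalPeriod_lt_of_exchange_two hu hoy (by simp) (by simp) fun x hxu hxy => ?_
      rw [mul_apply, swap_apply_of_ne_of_ne hxu hxy]
  push Not at hswap
  -- the arcs from the first cycle to the second are invariant under a step forward on the first
  -- and a step backward on the second cycle
  have hinv : ∀ u y, π.SameCycle o u → π.SameCycle y₁ y → (D.Adj (π u) y ↔ D.Adj u (π y)) := by
    intro u y hu hy'
    have := iff_of_forall_imp (π := prodCongr π π.symm)
      (p := fun q : V × V => π.SameCycle o q.1 ∧ π.SameCycle y₁ q.2 ∧ D.Adj q.1 q.2) ?_ (u, π y)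
    · simpa [hu, hy'] using this
    · rintro ⟨u, y⟩ ⟨hu, hy', h⟩
      have hy'' : π.SameCycle y₁ (π.symm y) := sameCycle_symm_apply_right.2 hy'
      have hu' : π.SameCycle o (π u) := sameCycle_apply_right.2 hu
      refine ⟨hu', hy'', (hadj _ _ hu' fun h' => hy (h'.trans hy''.symm)).resolve_right ?_⟩
      exact hswap u _ hu hy'' (by simpa using h)
  have hback : ∀ u y, π.SameCycle o u → π.SameCycle y₁ y → ¬ D.Adj u y → D.Adj y u :=
    fun u y hu hy' => (hadj u y hu fun h => hy (h.trans hy'.symm)).resolve_left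
  -- no pair is joined by arcs in both directions
  have hnot : ¬ D.Adj u₂ y₂ := by
    have hu' : π.SameCycle o (π.symm u₂) := sameCycle_symm_apply_right.2 hu₂
    have := hinv _ y₂ hu' hyy
    rw [apply_symm_apply] at this
    rw [this]
    exact fun h => hswap _ _ hu' hyy h (by simpa using h₂)
  obtain ⟨v, hv, hvy⟩ : ∃ v, π.SameCycle o v ∧ ¬ D.Adj v y₁ := by
    obtain ⟨k, rfl⟩ := hyy.exists_nat_pow_eq
    clear h₂ hyy
    induction k generalizing u₂ with
    | zero => exact ⟨u₂, hu₂, hnot⟩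
    | succ k ih =>
      refine ih (u₂ := π u₂) (sameCycle_apply_right.2 hu₂) ?_
      rwa [hinv _ _ hu₂ (sameCycle_pow_right.2 (SameCycle.refl _ _)), ← mul_apply, ← pow_succ']
  -- going round the first cycle, the arcs to `y₁` stop after `a` and start again after `c`
  obtain ⟨a, ha, ha₁, ha₂⟩ := (hu₁.symm.trans hv).exists_step (p := fun u => D.Adj u y₁) h₁ hvy
  obtain ⟨c, hc, hc₁, hc₂⟩ := (hv.symm.trans hu₁).exists_step (p := fun u => ¬ D.Adj u y₁) hvy
    (not_not.2 h₁)
  rw [not_not] at hc₂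
  replace ha := hu₁.trans ha
  replace hc := hv.trans hc
  obtain ⟨b, rfl⟩ : ∃ b, π b = y₁ := ⟨π.symm y₁, by simp⟩
  have hyb : π.SameCycle (π b) b := sameCycle_apply_left.2 (SameCycle.refl _ _)
  have hyd : π.SameCycle (π b) (π b) := SameCycle.refl _ _
  have hob : ¬ π.SameCycle o b := fun h => hy (sameCycle_apply_right.2 h)
  have hac : a ≠ c := fun e => hc₁ (e ▸ ha₁)
  have hbd : b ≠ π b := by
    intro e
    have := (hinv a b ha hyb).2 ha₁
    rw [e] at this
    exact ha₂ this
  have hab : a ≠ b := fun e => hob (e ▸ ha)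
  have hcb : c ≠ b := fun e => hob (e ▸ hc)
  have had : a ≠ π b := fun e => hy (e ▸ ha)
  have hcd : c ≠ π b := fun e => hy (e ▸ hc)
  have ea : π.exchange a b c (π b) a = π b := by
    simp [exchange, swap_apply_of_ne_of_ne hac had, swap_apply_of_ne_of_ne hab hac]
  have eb : π.exchange a b c (π b) b = π c := by
    simp [exchange, swap_apply_of_ne_of_ne hcb.symm hbd, swap_apply_of_ne_of_ne hac.symm hcb]
  have ec : π.exchange a b c (π b) c = π (π b) := by
    simp [exchange, swap_apply_of_ne_of_ne hbd.symm hcd.symm,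
      swap_apply_of_ne_of_ne had.symm hbd.symm]
  have ed : π.exchange a b c (π b) (π b) = π a := by
    simp [exchange]
  have er : ∀ x, x ≠ a → x ≠ b → x ≠ c → x ≠ π b → π.exchange a b c (π b) x = π x := by
    intro x h1 h2 h3 h4
    simp [exchange, swap_apply_of_ne_of_ne h3 h4, swap_apply_of_ne_of_ne h2 h3,
      swap_apply_of_ne_of_ne h1 h2]
  refine ⟨a, b, c, π b, fun x => ?_,
    minimalPeriod_lt_of_exchange_four ha hc hob hac ea eb ec ed er⟩
  have hπ : ∀ {u}, π.SameCycle o u → π.SameCycle o (π u) := sameCycle_apply_right.2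
  by_cases hxa : x = a
  · right; rw [hxa, ea]; exact ha₁
  by_cases hxb : x = b
  · right; rw [hxb, eb]
    exact hback _ _ (hπ hc) hyb fun h => hc₁ ((hinv _ _ hc hyb).1 h)
  by_cases hxc : x = c
  · right; rw [hxc, ec]
    exact (hinv _ _ hc hyd).1 hc₂
  by_cases hxd : x = π b
  · right; rw [hxd, ed]
    exact hback _ _ (hπ ha) hyd ha₂
  · left; exact er x hxa hxb hxc hxd

/-- The heart of the merging step. Let `W` be a weight that vertices of a partite set share and that
is largest on the arcs. If the cycle of `o` does not contain all vertices, then an exchange that does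
not decrease the total weight makes it longer. -/
theorem exists_exchange (hD : D.IsExtendedSemicomplete P) (hs : D.IsStrong) {W : V → V → ℕ}
    (htwin : ∀ u v w, P u v → W u w = W v w)
    (hmax : ∀ u v x y, D.Adj u v → W x y ≤ W u v)
    (ho : ∃ x, ¬ π.SameCycle o x) :
    ∃ a b c d, ∑ x, W x (π x) ≤ ∑ x, W x (π.exchange a b c d x) ∧
      Function.minimalPeriod π o < Function.minimalPeriod (π.exchange a b c d) o := by
  have harcs : (∃ a b c d,
      (∀ x, π.exchange a b c d x = π x ∨ D.Adj x (π.exchange a b c d x)) ∧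
      Function.minimalPeriod π o < Function.minimalPeriod (π.exchange a b c d) o) →
      ∃ a b c d, ∑ x, W x (π x) ≤ ∑ x, W x (π.exchange a b c d x) ∧
      Function.minimalPeriod π o < Function.minimalPeriod (π.exchange a b c d) o := by
    rintro ⟨a, b, c, d, h, hlt⟩
    refine ⟨a, b, c, d, Finset.sum_le_sum fun x _ => ?_, hlt⟩
    rcases h x with h | h
    · rw [h]
    · exact hmax _ _ _ _ h
  -- exchanging the successors of two vertices of a partite set keeps the total weight
  by_cases hA : ∃ u y, π.SameCycle o u ∧ ¬ π.SameCycle o y ∧ P u y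
  · obtain ⟨u, y, hu, hy, hP⟩ := hA
    have hex : π.exchange u y y y = π * swap u y := exchange_two _ _ _
    refine ⟨u, y, y, y, ?_, ?_⟩
    · rw [hex, ← Equiv.sum_comp (swap u y) fun x => W x ((π * swap u y) x)]
      refine le_of_eq (Finset.sum_congr rfl fun x _ => ?_)
      rw [mul_apply, swap_apply_self]
      by_cases hxu : x = u
      · rw [hxu, swap_apply_left, htwin _ _ _ hP]
      by_cases hxy : x = y
      · rw [hxy, swap_apply_right, htwin _ _ _ hP]
      · rw [swap_apply_of_ne_of_ne hxu hxy]
    · rw [hex]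
      refine minimalPeriod_lt_of_exchange_two hu hy (by simp) (by simp) fun x h1 h2 => ?_
      rw [mul_apply, swap_apply_of_ne_of_ne h1 h2]
  push Not at hA
  have hadj : ∀ u y, π.SameCycle o u → ¬ π.SameCycle o y → D.Adj u y ∨ D.Adj y u :=
    fun u y hu hy => hD.arc_between u y (hA u y hu hy)
  apply harcs
  by_contra hno
  -- all arcs between the cycle of `o` and another cycle have the same direction
  have hone : ∀ u₁ u₂ y₁ y₂, π.SameCycle o u₁ → π.SameCycle o u₂ → ¬ π.SameCycle o y₁ →
      π.SameCycle y₁ y₂ → D.Adj u₁ y₁ → ¬ D.Adj y₂ u₂ := fun u₁ u₂ y₁ y₂ a1 a2 a3 a4 a5 a6 =>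
    hno (exists_exchange_of_arcs_both_ways hadj a1 a2 a3 a4 a5 a6)
  -- `z` is dominated by the cycle of `o`, `z'` dominates it, and there is an arc from `z` to `z'`
  obtain ⟨x, hx⟩ := ho
  obtain ⟨u, y, huy, hu, hy⟩ := (hs o x).exists_exit (p := π.SameCycle o) (SameCycle.refl _ _) hx
  obtain ⟨z, z', hzz, ⟨hz, v, hv, hvz⟩, hz'⟩ := (hs y o).exists_exit
    (p := fun z => ¬ π.SameCycle o z ∧ ∃ v, π.SameCycle o v ∧ D.Adj v z)
    ⟨hy, u, hu, huy⟩ (fun h => h.1 (SameCycle.refl _ _))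
  have hoz' : ¬ π.SameCycle o z' := fun h => hone v z' z z hv h hz (SameCycle.refl _ _) hvz hzz
  have hnz' : ∀ v, π.SameCycle o v → ¬ D.Adj v z' := fun v hv h => hz' ⟨hoz', v, hv, h⟩
  -- the exchange `o → π z`, `z → z'`, `w → π o`, where `w` is the predecessor of `z'`
  set w := π.symm z' with hw
  have hπw : π w = z' := by simp [hw]
  have hzw : ¬ π.SameCycle z w := by
    intro h
    have h' : π.SameCycle z z' := hπw ▸ sameCycle_apply_right.2 h
    exact (hadj o z' (SameCycle.refl _ _) hoz').elim (hnz' o (SameCycle.refl _ _))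
      (hone v o z z' hv (SameCycle.refl _ _) hz h' hvz)
  have how : ¬ π.SameCycle o w := fun h => hoz' (hπw ▸ sameCycle_apply_right.2 h)
  have hozz : o ≠ z := fun e => hz (e ▸ SameCycle.refl _ _)
  have howw : o ≠ w := fun e => how (e ▸ SameCycle.refl _ _)
  have hzww : z ≠ w := fun e => hzw (e ▸ SameCycle.refl _ _)
  have hex : π.exchange o z w w = π * swap o z * swap z w := exchange_three _ _ _ _
  have ho' : (π * swap o z * swap z w) o = π z := by
    simp [mul_apply, swap_apply_of_ne_of_ne hozz howw]
  have hz1 : (π * swap o z * swap z w) z = π w := by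
    simp [mul_apply, swap_apply_of_ne_of_ne howw.symm hzww.symm]
  have hw1 : (π * swap o z * swap z w) w = π o := by simp [mul_apply]
  have hrest : ∀ x, x ≠ o → x ≠ z → x ≠ w → (π * swap o z * swap z w) x = π x := by
    intro x h1 h2 h3
    simp [mul_apply, swap_apply_of_ne_of_ne h2 h3, swap_apply_of_ne_of_ne h1 h2]
  refine hno ⟨o, z, w, w, fun x => ?_, ?_⟩
  · rw [hex]
    have hπz : ¬ π.SameCycle o (π z) := fun h => hz (sameCycle_apply_right.1 h)
    by_cases hxo : x = o
    · subst hxo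
      rw [ho']
      refine .inr ((hadj x _ (SameCycle.refl _ _) hπz).resolve_right ?_)
      exact hone v x z _ hv (SameCycle.refl _ _) hz
        (sameCycle_apply_right.2 (SameCycle.refl _ _)) hvz
    by_cases hxz : x = z
    · subst hxz
      rw [hz1, hπw]
      exact .inr hzz
    by_cases hxw : x = w
    · rw [hxw, hw1]
      have hπo : π.SameCycle o (π o) := sameCycle_apply_right.2 (SameCycle.refl _ _)
      refine .inr ((hadj _ w hπo how).resolve_left fun h => ?_)
      exact (hadj o z' (SameCycle.refl _ _) hoz').elim (hnz' o (SameCycle.refl _ _))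
        (hone (π o) o w z' hπo (SameCycle.refl _ _) how (sameCycle_of_apply_eq hπw) h)
    · exact .inl (hrest x hxo hxz hxw)
  · rw [hex]
    exact minimalPeriod_lt_of_exchange_three (SameCycle.refl _ _) hz how hzw ho' hz1 hw1 hrest

end Digraph.IsExtendedSemicomplete

/-! ### Programs whose only loops are counting loops -/

namespace RAM

open Polynomial

/-- Programs in which every loop is a counting loop. `loop c k p` runs `p` with the counter, register
`0` of array `c`, going from `0` to `n + k - 1`, where `n` is the content of register `0` of array
`0`. -/
inductive Cmd : Type
  | skip
  | assign (a : ℕ) (i e : Expr)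
  | seq (p q : Cmd)
  | ite (e : Expr) (p q : Cmd)
  | loop (c k : ℕ) (p : Cmd)

/-- The memory as a function of the memory before the run. -/
def Cmd.exec : Cmd → Store → Store
  | .skip, σ => σ
  | .assign a i e, σ => σ.write a (i.eval σ) (e.eval σ)
  | .seq p q, σ => q.exec (p.exec σ)
  | .ite e p q, σ => if e.eval σ ≠ 0 then p.exec σ else q.exec σ
  | .loop c k p, σ =>
    Nat.rec (σ.write c 0 0) (fun i τ => (p.exec τ).write c 0 (i + 1)) (σ 0 0 + k)

/-- The loops become `while` loops that test whether `n + k` exceeds the counter. -/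
def Cmd.compile : Cmd → Prog
  | .skip => .skip
  | .assign a i e => .assign a i e
  | .seq p q => .seq p.compile q.compile
  | .ite e p q => .ite e p.compile q.compile
  | .loop c k p =>
    .seq (.assign c (.const 0) (.const 0))
      (.while (.sub (.add (.read 0 (.const 0)) (.const k)) (.read c (.const 0)))
        (.seq p.compile (.assign c (.const 0) (.add (.read c (.const 0)) (.const 1)))))

/-- Whether the program contains an instruction that writes to the array `a`. -/
def Cmd.writes (a : ℕ) : Cmd → Bool
  | .skip => false
  | .assign b _ _ => a == b
  | .seq p q => p.writes a || q.writes a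
  | .ite _ p q => p.writes a || q.writes a
  | .loop c _ p => a == c || p.writes a

/-- No program that is followed by another one changes the array that holds `n`, and no loop changes
that array or its counter in its body. -/
def Cmd.wf : Cmd → Bool
  | .skip => true
  | .assign _ _ _ => true
  | .seq p q => p.wf && q.wf && !p.writes 0
  | .ite _ p q => p.wf && q.wf
  | .loop c _ p => c != 0 && !p.writes c && !p.writes 0 && p.wf

/-- A bound on the number of steps, as a polynomial in `n`. -/
noncomputable def Cmd.time : Cmd → ℕ[X]
  | .skip => 1
  | .assign _ i e => C (i.cost + e.cost + 1)
  | .seq p q => p.time + q.time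
  | .ite e p q => C (e.cost + 1) + p.time + q.time
  | .loop _ k p => 11 + (X + C k) * (14 + p.time)

theorem Store.write_apply (σ : Store) (a i v b j : ℕ) :
    σ.write a i v b j = if b = a ∧ j = i then v else σ b j := by
  unfold Store.write
  by_cases hb : b = a
  · subst hb
    by_cases hj : j = i <;> simp [hj]
  · simp [hb]

@[simp]
theorem Store.write_same (σ : Store) (a i v : ℕ) : σ.write a i v a i = v := by
  simp [Store.write_apply]

theorem Store.write_same_apply (σ : Store) (a i v j : ℕ) :
    σ.write a i v a j = if j = i then v else σ a j := by
  simp [Store.write_apply]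

@[simp]
theorem Store.write_of_ne (σ : Store) {a b : ℕ} (i v : ℕ) (h : b ≠ a) :
    σ.write a i v b = σ b := by
  funext j
  simp [Store.write_apply, h]

/-- A program leaves the arrays it does not write to as they are. -/
theorem Cmd.exec_apply_of_writes {a : ℕ} :
    ∀ {p : Cmd} (σ : Store), p.writes a = false → p.exec σ a = σ a := by
  intro p
  induction p with
  | skip => intro σ _; rfl
  | assign b i e =>
    intro σ h
    exact Store.write_of_ne _ _ _ (by simpa [Cmd.writes] using h)
  | seq p q ihp ihq =>
    intro σ h
    simp only [Cmd.writes, Bool.or_eq_false_iff] at h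
    exact (ihq _ h.2).trans (ihp _ h.1)
  | ite e p q ihp ihq =>
    intro σ h
    simp only [Cmd.writes, Bool.or_eq_false_iff] at h
    unfold Cmd.exec
    split_ifs
    · exact ihp _ h.1
    · exact ihq _ h.2
  | loop c k p ih =>
    intro σ h
    simp only [Cmd.writes, Bool.or_eq_false_iff, beq_eq_false_iff_ne] at h
    unfold Cmd.exec
    induction σ 0 0 + k with
    | zero => exact Store.write_of_ne _ _ _ h.1
    | succ m ihm => exact (Store.write_of_ne _ _ _ h.1).trans ((ih _ h.2).trans ihm)

/-- Loop invariants: the step may use that the counter has the value `i` and that the arrays that the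
loop does not write to are as they were. -/
theorem Cmd.exec_loop_induction {c k : ℕ} {p : Cmd} {σ : Store} (I : ℕ → Store → Prop)
    (h0 : I 0 (σ.write c 0 0))
    (hs : ∀ i τ, i < σ 0 0 + k → τ c 0 = i →
      (∀ a, (Cmd.loop c k p).writes a = false → τ a = σ a) → I i τ →
      I (i + 1) ((p.exec τ).write c 0 (i + 1))) :
    I (σ 0 0 + k) ((Cmd.loop c k p).exec σ) := by
  let st : ℕ → Store := fun i =>
    Nat.rec (σ.write c 0 0) (fun i τ => (p.exec τ).write c 0 (i + 1)) i
  have hctr : ∀ i, st i c 0 = i := by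
    intro i
    cases i <;> exact Store.write_same _ _ _ _
  have hframe : ∀ a, (Cmd.loop c k p).writes a = false → ∀ i, st i a = σ a := by
    intro a h i
    simp only [Cmd.writes, Bool.or_eq_false_iff, beq_eq_false_iff_ne] at h
    induction i with
    | zero => exact Store.write_of_ne _ _ _ h.1
    | succ i ih =>
      exact (Store.write_of_ne _ _ _ h.1).trans ((Cmd.exec_apply_of_writes _ h.2).trans ih)
  have key : ∀ i, i ≤ σ 0 0 + k → I i (st i) := by
    intro i
    induction i with
    | zero => exact fun _ => h0
    | succ i ih =>
      exact fun hi => hs i (st i) (by omega) (hctr i) (fun a h => hframe a h i) (ih (by omega))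
  exact key _ le_rfl

/-- The compiled program computes `exec`, in polynomial time. -/
theorem Cmd.runs_compile : ∀ {p : Cmd}, p.wf = true → ∀ σ : Store,
    ∃ t, t ≤ p.time.eval (σ 0 0) ∧ Runs p.compile σ (p.exec σ) t := by
  intro p
  induction p with
  | skip => exact fun _ σ => ⟨1, by simp [Cmd.time], .skip σ⟩
  | assign a i e => exact fun _ σ => ⟨_, by simp [Cmd.time], .assign a i e σ⟩
  | seq p q ihp ihq =>
    intro h σ
    simp only [Cmd.wf, Bool.and_eq_true, Bool.not_eq_true'] at h
    obtain ⟨⟨hp, hq⟩, h0⟩ := h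
    obtain ⟨s, hs, hp⟩ := ihp hp σ
    obtain ⟨t, ht, hq⟩ := ihq hq (p.exec σ)
    rw [Cmd.exec_apply_of_writes σ h0] at ht
    refine ⟨s + t, ?_, .seq hp hq⟩
    simp only [Cmd.time, eval_add]
    omega
  | ite e p q ihp ihq =>
    intro h σ
    simp only [Cmd.wf, Bool.and_eq_true] at h
    by_cases he : e.eval σ = 0
    · obtain ⟨t, ht, hr⟩ := ihq h.2 σ
      refine ⟨_, ?_, by simpa [Cmd.exec, he] using .ite_false he hr⟩
      simp only [Cmd.time, eval_add, eval_C]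
      omega
    · obtain ⟨t, ht, hr⟩ := ihp h.1 σ
      refine ⟨_, ?_, by simpa [Cmd.exec, he] using .ite_true he hr⟩
      simp only [Cmd.time, eval_add, eval_C]
      omega
  | loop c k p ih =>
    intro h σ
    simp only [Cmd.wf, Bool.and_eq_true, bne_iff_ne, Bool.not_eq_true'] at h
    obtain ⟨⟨⟨hc, hpc⟩, hp0⟩, hp⟩ := h
    let st : ℕ → Store := fun i =>
      Nat.rec (σ.write c 0 0) (fun i τ => (p.exec τ).write c 0 (i + 1)) i
    have hctr : ∀ i, st i c 0 = i := by
      intro i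
      cases i <;> exact Store.write_same _ _ _ _
    have hsize : ∀ i, st i 0 0 = σ 0 0 := by
      intro i
      induction i with
      | zero => exact congrFun (Store.write_of_ne _ _ _ hc.symm) 0
      | succ i ih' =>
        have h1 : st (i + 1) 0 = p.exec (st i) 0 := Store.write_of_ne _ _ _ hc.symm
        rw [h1, Cmd.exec_apply_of_writes _ hp0, ih']
    have key : ∀ m i, i + m = σ 0 0 + k →
        ∃ t, t ≤ 8 + m * (14 + p.time.eval (σ 0 0)) ∧
          Runs (.while (.sub (.add (.read 0 (.const 0)) (.const k)) (.read c (.const 0)))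
            (.seq p.compile (.assign c (.const 0) (.add (.read c (.const 0)) (.const 1)))))
            (st i) (st (σ 0 0 + k)) t := by
      intro m
      induction m with
      | zero =>
        intro i hi
        obtain rfl : i = σ 0 0 + k := hi
        refine ⟨_, ?_, .while_false ?_⟩
        · simp [Expr.cost]
        · simp [Expr.eval, hctr, hsize]
      | succ m ihm =>
        intro i hi
        obtain ⟨t, ht, hr⟩ := ihm (i + 1) (by omega)
        obtain ⟨s, hs, hr'⟩ := ih hp (st i)
        rw [hsize] at hs
        have hassign := Runs.assign c (.const 0) (.add (.read c (.const 0)) (.const 1))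
          (p.exec (st i))
        have hval : (p.exec (st i)).write c 0 (p.exec (st i) c 0 + 1) = st (i + 1) := by
          rw [Cmd.exec_apply_of_writes _ hpc, hctr]
        simp only [Expr.eval, hval] at hassign
        refine ⟨_, ?_, .while_true ?_ (.seq hr' hassign) hr⟩
        · simp only [Expr.cost]
          rw [Nat.succ_mul]
          omega
        · simp only [Expr.eval, hctr, hsize]
          omega
    obtain ⟨t, ht, hr⟩ := key (σ 0 0 + k) 0 (by omega)
    refine ⟨_, ?_, .seq (.assign c (.const 0) (.const 0) σ) hr⟩
    simp only [Cmd.time, Expr.cost, eval_add, eval_mul, eval_X, eval_C, eval_ofNat]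
    omega

end RAM

/-! ### Notation for programs -/

namespace RAM

/-- The programs of the list, one after the other. -/
def Cmd.block : List Cmd → Cmd
  | [] => .skip
  | p :: l => .seq p (block l)

/-- Register `0` of the array `a`. -/
abbrev Expr.reg (a : ℕ) : Expr := .read a (.const 0)

/-- Write to register `0` of the array `a`. -/
abbrev Cmd.set (a : ℕ) (e : Expr) : Cmd := .assign a (.const 0) e

@[simp] theorem Cmd.exec_block_nil (σ : Store) : (Cmd.block []).exec σ = σ := rfl

@[simp] theorem Cmd.exec_block_cons (p : Cmd) (l : List Cmd) (σ : Store) :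
    (Cmd.block (p :: l)).exec σ = (Cmd.block l).exec (p.exec σ) := rfl

@[simp] theorem Cmd.exec_skip (σ : Store) : Cmd.skip.exec σ = σ := rfl

@[simp] theorem Cmd.exec_assign (a : ℕ) (i e : Expr) (σ : Store) :
    (Cmd.assign a i e).exec σ = σ.write a (i.eval σ) (e.eval σ) := rfl

@[simp] theorem Cmd.exec_ite (e : Expr) (p q : Cmd) (σ : Store) :
    (Cmd.ite e p q).exec σ = if e.eval σ ≠ 0 then p.exec σ else q.exec σ := rfl

attribute [simp] Expr.eval

theorem Store.write_array (σ : Store) (a i v : ℕ) :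
    σ.write a i v a = Function.update (σ a) i v := by
  simp [Store.write]

theorem Cmd.exec_loop_zero_induction {n c : ℕ} {p : Cmd} {σ : Store} (hn : σ 0 0 = n)
    (I : ℕ → Store → Prop) (h0 : I 0 (σ.write c 0 0))
    (hs : ∀ i τ, i < n → τ c 0 = i →
      (∀ a, (Cmd.loop c 0 p).writes a = false → τ a = σ a) → I i τ →
      I (i + 1) ((p.exec τ).write c 0 (i + 1))) :
    I n ((Cmd.loop c 0 p).exec σ) := by
  subst hn
  exact Cmd.exec_loop_induction (k := 0) I h0 hs

/-! ### The weights as a program -/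

/-- `i * n` for all `i`, which gives access to the rows of the adjacency matrix -/
abbrev rowA : ℕ := 4
/-- the weight of a pair of vertices of the same partite set -/
abbrev loA : ℕ := 5
/-- the weight of an arc -/
abbrev hiA : ℕ := 6
/-- the result of `weigh` -/
abbrev wA : ℕ := 7
/-- loop counters -/
abbrev iA : ℕ := 8
/-- loop counters -/
abbrev jA : ℕ := 9

/-- Weight of an arc. -/
def hiWeight (n : ℕ) : ℕ := (n + 1) * (n + 1) + (n + 1)

/-- Weight of a pair of vertices of the same partite set. -/
def loWeight (n : ℕ) : ℕ := (n + 1) * (n + 1)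

open Classical in
/-- The weight of the step from `i` to `j`. Steps that a G-cycle cannot make have weight `0`. For
extended semicomplete digraphs, two vertices without arcs between them are in the same partite set. -/
noncomputable def weight {n : ℕ} (D : Digraph (Fin n)) (i j : Fin n) : ℕ :=
  if D.Adj i j then hiWeight n else if D.Adj j i then 0 else loWeight n

/-- Compute the weight of the step from `x` to `y`. -/
def weigh (x y : Expr) : Cmd :=
  .ite (.read 1 (.add (.read rowA x) y)) (.set wA (.reg hiA))
    (.ite (.read 1 (.add (.read rowA y) x)) (.set wA (.const 0)) (.set wA (.reg loA)))

/-- Prepare the row offsets and the two weights. -/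
def setup : Cmd := .block [
  .assign rowA (.const 0) (.const 0),
  .loop iA 0 (.assign rowA (.add (.reg iA) (.const 1))
    (.add (.read rowA (.reg iA)) (.reg 0))),
  .set loA (.const 0),
  .loop iA 1 (.set loA (.add (.reg loA) (.add (.reg 0) (.const 1)))),
  .set hiA (.add (.reg loA) (.add (.reg 0) (.const 1)))]

/-- The memory holds the data from which `weigh` computes the weights. -/
structure Env {n : ℕ} (D : Digraph (Fin n)) (σ : Store) : Prop where
  size : σ 0 0 = n
  adj : ∀ i j : Fin n, σ 1 (i * n + j) ≠ 0 ↔ D.Adj i j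
  row : ∀ i : Fin n, σ rowA i = i * n
  lo : σ loA 0 = loWeight n
  hi : σ hiA 0 = hiWeight n

/-- The arrays on which `Env` depends. -/
abbrev envArrays : List ℕ := [0, 1, rowA, loA, hiA]

variable {n : ℕ} {D : Digraph (Fin n)} {σ τ : Store}

theorem Env.congr (h : Env D σ) (he : ∀ a ∈ envArrays, τ a = σ a) : Env D τ := by
  simp only [envArrays, List.forall_mem_cons] at he
  obtain ⟨h0, h1, h2, h3, h4, -⟩ := he
  exact ⟨h0 ▸ h.size, h1 ▸ h.adj, h2 ▸ h.row, h3 ▸ h.lo, h4 ▸ h.hi⟩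

theorem Env.exec (h : Env D σ) (p : Cmd) (hp : ∀ a ∈ envArrays, p.writes a = false) :
    Env D (p.exec σ) :=
  h.congr fun a ha => Cmd.exec_apply_of_writes σ (hp a ha)

theorem Env.write (h : Env D σ) {a : ℕ} (ha : a ∉ envArrays) (i v : ℕ) :
    Env D (σ.write a i v) :=
  h.congr fun _ hb => Store.write_of_ne _ _ _ fun e => ha (e ▸ hb)

theorem exec_weigh (h : Env D σ) {x y : Expr} {i j : Fin n} (hx : x.eval σ = i)
    (hy : y.eval σ = j) : (weigh x y).exec σ = σ.write wA 0 (weight D i j) := by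
  have h1 : (Expr.read 1 (.add (.read rowA x) y)).eval σ ≠ 0 ↔ D.Adj i j := by
    simpa only [Expr.eval, hx, hy, h.row] using h.adj i j
  have h2 : (Expr.read 1 (.add (.read rowA y) x)).eval σ ≠ 0 ↔ D.Adj j i := by
    simpa only [Expr.eval, hx, hy, h.row] using h.adj j i
  rw [weigh, Cmd.exec_ite, weight]
  by_cases a1 : D.Adj i j
  · rw [if_pos (h1.2 a1), if_pos a1]
    simp [h.hi]
  rw [if_neg (mt h1.1 a1), if_neg a1, Cmd.exec_ite]
  by_cases a2 : D.Adj j i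
  · rw [if_pos (h2.2 a2), if_pos a2]
    simp
  · rw [if_neg (mt h2.1 a2), if_neg a2]
    simp [h.lo]

theorem inputDigraph_adj (D : Digraph (Fin n)) (i j : Fin n) :
    inputDigraph D 1 (i * n + j) ≠ 0 ↔ D.Adj i j := by
  have hinj : ∀ i' j' : Fin n, i.val * n + j.val = i'.val * n + j'.val → i = i' ∧ j = j' := by
    intro i' j' h
    have hpos : 0 < n := j.pos
    have hd := congrArg (· / n) h
    have hm := congrArg (· % n) h
    simp only [add_comm (_ * n), Nat.add_mul_div_right _ _ hpos, Nat.div_eq_of_lt j.2, Nat.div_eq_of_lt j'.2, zero_add,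
      Nat.add_mul_mod_self_right, Nat.mod_eq_of_lt j.2, Nat.mod_eq_of_lt j'.2] at hd hm
    exact ⟨Fin.ext hd, Fin.ext hm⟩
  have hiff : (∃ i' j' : Fin n, i.val * n + j.val = i'.val * n + j'.val ∧ D.Adj i' j') ↔
      D.Adj i j := by
    refine ⟨?_, fun h => ⟨i, j, rfl, h⟩⟩
    rintro ⟨i', j', he, h⟩
    obtain ⟨rfl, rfl⟩ := hinj i' j' he
    exact h
  simp [inputDigraph, hiff]

theorem env_setup (D : Digraph (Fin n)) : Env D (setup.exec (inputDigraph D)) := by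
  have hfr : ∀ a, setup.writes a = false → setup.exec (inputDigraph D) a = inputDigraph D a :=
    fun a h => Cmd.exec_apply_of_writes _ h
  have hn : inputDigraph D 0 0 = n := by simp [inputDigraph]
  simp only [setup, Cmd.exec_block_cons, Cmd.exec_block_nil] at *
  set σ₁ := (Cmd.assign rowA (.const 0) (.const 0)).exec (inputDigraph D) with hσ₁
  have hn₁ : σ₁ 0 0 = n := by simp [hσ₁, hn]
  set σ₂ := (Cmd.loop iA 0 _).exec σ₁ with hσ₂
  have hrow : ∀ i ≤ n, σ₂ rowA i = i * n := by
    refine Cmd.exec_loop_zero_induction hn₁ (fun m τ => ∀ i ≤ m, τ rowA i = i * n) ?_ ?_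
    · intro i hi
      obtain rfl : i = 0 := by omega
      simp [hσ₁]
    · intro m τ hm hc hf ih i hi
      have h0 : τ 0 0 = n := by rw [hf 0 (by decide), hn₁]
      by_cases hi' : i = m + 1
      · subst hi'
        simp [hc, h0, ih m le_rfl, Nat.succ_mul]
      · simp [hc, Store.write_same_apply, hi', ih i (by omega)]
  have hn₂ : σ₂ 0 0 = n := by
    rw [hσ₂, Cmd.exec_apply_of_writes _ (by decide), hn₁]
  set σ₃ := (Cmd.set loA (.const 0)).exec σ₂ with hσ₃
  have hn₃ : σ₃ 0 0 = n := by simp [hσ₃, hn₂]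
  set σ₄ := (Cmd.loop iA 1 _).exec σ₃ with hσ₄
  have hlo : σ₄ loA 0 = (n + 1) * (n + 1) := by
    have := Cmd.exec_loop_induction (σ := σ₃) (c := iA) (k := 1)
      (p := .set loA (.add (.reg loA) (.add (.reg 0) (.const 1))))
      (fun m τ => τ loA 0 = m * (n + 1)) (by simp [hσ₃]) ?_
    · rwa [hn₃] at this
    · intro m τ hm hc hf ih
      have h0 : τ 0 0 = n := by rw [hf 0 (by decide), hn₃]
      simp [h0, ih, Nat.succ_mul]
  have hn₄ : σ₄ 0 0 = n := by
    rw [hσ₄, Cmd.exec_apply_of_writes _ (by decide), hn₃]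
  refine ⟨?_, ?_, ?_, ?_, ?_⟩
  · simp [hn₄]
  · rw [hfr 1 (by decide)]
    exact inputDigraph_adj D
  · intro i
    have : σ₄ rowA = σ₂ rowA := by
      rw [hσ₄, Cmd.exec_apply_of_writes _ (by decide), hσ₃]
      simp
    simp [this, hrow i i.2.le]
  · simp [hlo, loWeight]
  · simp [hlo, hn₄, hiWeight]

end RAM

/-! ### The auction -/

/-- The state of an auction in which the person `i` values the object `j` at `W i j`. The prices of
the objects are `price`; `owner j` is `0` if the object `j` has no owner, otherwise the owner is
person `owner j - 1`; dually for `object i`. Objects without owner are free, and every person with an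
object has, up to `1`, an object of the best value minus price. -/
structure AuctionInv {n : ℕ} (W : Fin n → Fin n → ℕ) (K : ℕ) (price owner object : ℕ → ℕ) :
    Prop where
  object_eq_iff : ∀ i j : Fin n, object i = j + 1 ↔ owner j = i + 1
  object_le : ∀ i : Fin n, object i ≤ n
  owner_le : ∀ j : Fin n, owner j ≤ n
  price_eq_zero : ∀ j : Fin n, owner j = 0 → price j = 0
  slackness : ∀ i j k : Fin n, object i = j + 1 → W i k + price j ≤ W i j + price k + 1
  price_le : ∀ j : Fin n, price j ≤ K + 1

namespace AuctionInv

variable {n : ℕ} {W : Fin n → Fin n → ℕ} {K : ℕ} {price owner object : ℕ → ℕ}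

theorem init (W : Fin n → Fin n → ℕ) (K : ℕ) : AuctionInv W K 0 0 0 where
  object_eq_iff i j := by simp
  object_le i := Nat.zero_le _
  owner_le j := Nat.zero_le _
  price_eq_zero j h := rfl
  slackness i j k h := absurd h (by simp)
  price_le j := Nat.zero_le _

theorem exists_owner (h : AuctionInv W K price owner object) {j : Fin n} (hj : owner j ≠ 0) :
    ∃ i : Fin n, owner j = i + 1 := by
  have := h.owner_le j
  exact ⟨⟨owner j - 1, by omega⟩, by simp only; omega⟩

theorem exists_object (h : AuctionInv W K price owner object) {i : Fin n} (hi : object i ≠ 0) :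
    ∃ j : Fin n, object i = j + 1 := by
  have := h.object_le i
  exact ⟨⟨object i - 1, by omega⟩, by simp only; omega⟩

/-- As long as some person has no object, some object has no owner. -/
theorem exists_owner_eq_zero (h : AuctionInv W K price owner object) {i : Fin n}
    (hi : object i = 0) : ∃ j : Fin n, owner j = 0 := by
  by_contra! hcon
  choose f hf using fun j => h.exists_owner (hcon j)
  have hf' := fun j => (h.object_eq_iff (f j) j).2 (hf j)
  have hinj : Function.Injective f := by
    intro j j' e
    have := hf' j
    rw [e, hf' j'] at this
    exact Fin.ext (by omega)
  obtain ⟨j, hj⟩ := Finite.surjective_of_injective hinj i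
  have := hf' j
  rw [hj, hi] at this
  omega

/-- A person without object takes the object that is best at the current prices from its owner, and
raises its price by `1`. -/
theorem bid (h : AuctionInv W K price owner object) (hW : ∀ i j, W i j ≤ K) {i j : Fin n}
    (hi : object i = 0) (hj : ∀ k, W i k + price j ≤ W i j + price k) :
    AuctionInv W K (Function.update price j (price j + 1)) (Function.update owner j (i + 1))
      (Function.update (if owner j ≠ 0 then Function.update object (owner j - 1) 0 else object) i
        (j + 1)) := by
  have hval : ∀ {a b : Fin n}, a ≠ b → a.val ≠ b.val := fun hab e => hab (Fin.ext e)
  obtain ⟨l, hl⟩ := h.exists_owner_eq_zero hi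
  have hpj : price j ≤ K := by
    have := hj l
    rw [h.price_eq_zero l hl] at this
    have := hW i j
    omega
  have hne : ∀ {a b : Fin n}, a ≠ b → a.val ≠ b.val := fun hab e => hab (Fin.ext e)
  set object' := Function.update
    (if owner j ≠ 0 then Function.update object (owner j - 1) 0 else object) i (j + 1) with hobject'
  have hi' : object' i = j + 1 := Function.update_self _ _ _
  have hloser : ∀ i' : Fin n, i' ≠ i → owner j = i' + 1 → object' i' = 0 := by
    intro i' hii h'
    rw [hobject', Function.update_of_ne (hne hii), if_pos (by omega), h']
    simp
  have hother : ∀ i' : Fin n, i' ≠ i → owner j ≠ i' + 1 → object' i' = object i' := by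
    intro i' hii h'
    rw [hobject', Function.update_of_ne (hne hii)]
    split_ifs with h0
    · exact Function.update_of_ne (by omega) _ _
    · rfl
  have hobj : ∀ i' : Fin n, i' ≠ i → ∀ j' : Fin n,
      object' i' = j' + 1 ↔ object i' = j' + 1 ∧ j' ≠ j := by
    intro i' hii j'
    by_cases hlose : owner j = i' + 1
    · have hold := (h.object_eq_iff i' j).2 hlose
      rw [hloser i' hii hlose, hold]
      refine ⟨fun e => by omega, fun e => absurd (Fin.ext ?_) e.2⟩
      omega
    · rw [hother i' hii hlose]
      refine ⟨fun e => ⟨e, ?_⟩, And.left⟩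
      rintro rfl
      exact hlose ((h.object_eq_iff _ _).1 e)
  refine ⟨?_, ?_, ?_, ?_, ?_, ?_⟩
  · intro i' j'
    by_cases hii : i' = i
    · subst hii
      rw [hi']
      by_cases hjj : j' = j
      · subst hjj; simp
      · rw [Function.update_of_ne (hne hjj), ← h.object_eq_iff, hi]
        have := hne hjj
        omega
    · rw [hobj i' hii]
      by_cases hjj : j' = j
      · subst hjj
        have := hne hii
        simp only [Function.update_self]
        exact ⟨fun e => absurd rfl e.2, fun e => by omega⟩
      · rw [Function.update_of_ne (hne hjj), ← h.object_eq_iff]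
        simp [hjj]
  · intro i'
    by_cases hii : i' = i
    · subst hii; rw [hi']; omega
    · by_cases hlose : owner j = i' + 1
      · rw [hloser i' hii hlose]; exact Nat.zero_le _
      · rw [hother i' hii hlose]; exact h.object_le i'
  · intro j'
    by_cases hjj : j' = j
    · subst hjj; rw [Function.update_self]; omega
    · rw [Function.update_of_ne (hne hjj)]; exact h.owner_le j'
  · intro j'
    by_cases hjj : j' = j
    · subst hjj; rw [Function.update_self]; intro e; omega
    · rw [Function.update_of_ne (hne hjj), Function.update_of_ne (hne hjj)]
      exact h.price_eq_zero j'
  · intro i' j' k e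
    have hk : price k ≤ Function.update price j (price j + 1) k := by
      by_cases hkj : k = j
      · subst hkj; simp
      · rw [Function.update_of_ne (hne hkj)]
    by_cases hii : i' = i
    · subst hii
      obtain rfl : j' = j := Fin.ext (by omega)
      rw [Function.update_self]
      have := hj k
      omega
    · obtain ⟨e, hjj⟩ := (hobj i' hii j').1 e
      rw [Function.update_of_ne (hne hjj)]
      have := h.slackness i' j' k e
      omega
  · intro j'
    by_cases hjj : j' = j
    · subst hjj; rw [Function.update_self]; omega
    · rw [Function.update_of_ne (hne hjj)]; exact h.price_le j'

/-- When everybody has an object, the assignment is a permutation, and its total value is at most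
`n` below the largest total value of a permutation. -/
theorem exists_perm (h : AuctionInv W K price owner object) (hall : ∀ i : Fin n, object i ≠ 0) :
    ∃ π : Equiv.Perm (Fin n), (∀ i : Fin n, object i = π i + 1) ∧
      ∀ ρ : Equiv.Perm (Fin n), ∑ i, W i (ρ i) ≤ ∑ i, W i (π i) + n := by
  choose f hf using fun i => h.exists_object (hall i)
  have hinj : Function.Injective f := by
    intro i i' e
    have h1 := (h.object_eq_iff _ _).1 (hf i)
    have h2 := (h.object_eq_iff _ _).1 (hf i')
    rw [e, h2] at h1
    exact Fin.ext (by omega)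
  refine ⟨Equiv.ofBijective f (Finite.injective_iff_bijective.1 hinj), hf, fun ρ => ?_⟩
  set π : Equiv.Perm (Fin n) := Equiv.ofBijective f (Finite.injective_iff_bijective.1 hinj)
  have hsum : ∑ i, (W i (ρ i) + price (π i)) ≤ ∑ i, (W i (π i) + price (ρ i) + 1) :=
    Finset.sum_le_sum fun i _ => h.slackness i (π i) (ρ i) (hf i)
  simp only [Finset.sum_add_distrib, Finset.sum_const, Finset.card_univ, Fintype.card_fin,
    smul_eq_mul, mul_one] at hsum
  -- under both permutations every object is paid for once
  have hπ := Equiv.sum_comp π fun j : Fin n => price j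
  have hρ := Equiv.sum_comp ρ fun j : Fin n => price j
  omega

end AuctionInv

/-! ### The auction as a program -/

namespace RAM

/-- the prices of the auction -/
abbrev priceA : ℕ := 10
/-- the owners of the objects -/
abbrev ownerA : ℕ := 11
/-- the objects of the persons -/
abbrev objectA : ℕ := 12
/-- the best object for a person -/
abbrev bestA : ℕ := 13
/-- the value of that object -/
abbrev bestValueA : ℕ := 14
/-- loop counters -/
abbrev rA : ℕ := 15
/-- loop counters -/
abbrev sA : ℕ := 16
/-- loop counters -/
abbrev tA : ℕ := 17

/-- Find an object of the best value minus price for the person in `iA`. -/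
def findBest : Cmd := .block [
  .set bestA (.const 0),
  .loop jA 0 (.block [
    weigh (.reg iA) (.reg bestA),
    .set bestValueA (.reg wA),
    weigh (.reg iA) (.reg jA),
    .ite (.sub (.add (.reg wA) (.read priceA (.reg bestA)))
        (.add (.reg bestValueA) (.read priceA (.reg jA))))
      (.set bestA (.reg jA)) .skip])]

/-- The person in `iA` bids for its best object. -/
def placeBid : Cmd := .block [
  findBest,
  .assign priceA (.reg bestA) (.add (.read priceA (.reg bestA)) (.const 1)),
  .ite (.read ownerA (.reg bestA))
    (.assign objectA (.sub (.read ownerA (.reg bestA)) (.const 1)) (.const 0)) .skip,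
  .assign ownerA (.reg bestA) (.add (.reg iA) (.const 1)),
  .assign objectA (.reg iA) (.add (.reg bestA) (.const 1))]

/-- Every person without object bids. -/
def auctionRound : Cmd := .loop iA 0 (.ite (.read objectA (.reg iA)) .skip placeBid)

/-- Enough rounds to give an object to everybody: while someone has no object, every round raises some
price, and `(n + 3) ^ 3` exceeds the sum `n * (hiWeight n + 1)` of the largest possible prices. -/
def auction : Cmd := .loop rA 3 (.loop sA 3 (.loop tA 3 auctionRound))

variable {n : ℕ} {D : Digraph (Fin n)} {σ τ : Store}

theorem exec_findBest (h : Env D σ) {i : Fin n} (hi : σ iA 0 = i) :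
    ∃ j : Fin n, findBest.exec σ bestA 0 = j ∧
      ∀ k, weight D i k + σ priceA j ≤ weight D i j + σ priceA k := by
  have hn : ((Cmd.set bestA (.const 0)).exec σ) 0 0 = n := by simp [h.size]
  have key := Cmd.exec_loop_zero_induction (c := jA) (p := .block [
    weigh (.reg iA) (.reg bestA),
    .set bestValueA (.reg wA),
    weigh (.reg iA) (.reg jA),
    .ite (.sub (.add (.reg wA) (.read priceA (.reg bestA)))
        (.add (.reg bestValueA) (.read priceA (.reg jA))))
      (.set bestA (.reg jA)) .skip]) hn
    (fun m τ => ∃ j : Fin n, τ bestA 0 = j ∧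
      ∀ k : Fin n, k < m → weight D i k + σ priceA j ≤ weight D i j + σ priceA k) ?_ ?_
  · obtain ⟨j, hj, hbest⟩ := key
    exact ⟨j, hj, fun k => hbest k k.2⟩
  · exact ⟨⟨0, i.pos⟩, by simp, fun k hk => absurd hk (Nat.not_lt_zero _)⟩
  · rintro m τ hm hc hf ⟨j, hj, hbest⟩
    have hE : Env D τ := h.congr fun a ha => by
      rw [hf a (by revert a; decide)]
      exact Store.write_of_ne _ _ _ (by rintro rfl; revert ha; decide)
    have hi' : τ iA 0 = i := by rw [hf iA (by decide)]; simpa using hi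
    have hprice : τ priceA = σ priceA := by rw [hf priceA (by decide)]; simp
    have e1 := exec_weigh hE (x := .reg iA) (y := .reg bestA) (i := i) (j := j) hi' hj
    have hE2 : Env D ((τ.write wA 0 (weight D i j)).write bestValueA 0 (weight D i j)) :=
      (hE.write (by decide) _ _).write (by decide) _ _
    have e2 := exec_weigh hE2 (x := .reg iA) (y := .reg jA) (i := i) (j := ⟨m, hm⟩)
      (by simp [hi']) (by simp [hc])
    simp only [Cmd.exec_block_cons, Cmd.exec_block_nil, e1, Cmd.exec_assign, Expr.eval,
      Store.write_same, e2, Cmd.exec_ite, Cmd.exec_skip]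
    split_ifs with hcmp
    · refine ⟨⟨m, hm⟩, by simp [hc], fun k hk => ?_⟩
      simp [hj, hc, hprice] at hcmp
      rcases Nat.lt_succ_iff_lt_or_eq.1 hk with hk | hk
      · have := hbest k hk
        simp only
        omega
      · obtain rfl : k = ⟨m, hm⟩ := Fin.ext hk
        exact le_rfl
    · refine ⟨j, by simp [hj], fun k hk => ?_⟩
      simp [hj, hc, hprice] at hcmp
      rcases Nat.lt_succ_iff_lt_or_eq.1 hk with hk | hk
      · exact hbest k hk
      · obtain rfl : k = ⟨m, hm⟩ := Fin.ext hk
        simp only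
        omega

/-- The memory holds the state of an auction in which the values are the weights. -/
def IsAuction (D : Digraph (Fin n)) (σ : Store) : Prop :=
  Env D σ ∧ AuctionInv (weight D) (hiWeight n) (σ priceA) (σ ownerA) (σ objectA)

theorem IsAuction.congr (h : IsAuction D σ)
    (he : ∀ a ∈ [0, 1, rowA, loA, hiA, priceA, ownerA, objectA], τ a = σ a) : IsAuction D τ := by
  refine ⟨h.1.congr fun a ha => he a (by revert a; decide), ?_⟩
  rw [he priceA (by decide), he ownerA (by decide), he objectA (by decide)]
  exact h.2

theorem weight_le (D : Digraph (Fin n)) (i j : Fin n) : weight D i j ≤ hiWeight n := by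
  unfold weight loWeight hiWeight
  split_ifs <;> omega

theorem exec_placeBid (h : IsAuction D σ) {i : Fin n} (hi : σ iA 0 = i) (hfree : σ objectA i = 0) :
    IsAuction D (placeBid.exec σ) ∧
      ∑ j : Fin n, placeBid.exec σ priceA j = ∑ j : Fin n, σ priceA j + 1 := by
  obtain ⟨hE, hA⟩ := h
  obtain ⟨j, hj, hbest⟩ := exec_findBest hE hi
  have hprice : findBest.exec σ priceA = σ priceA := Cmd.exec_apply_of_writes _ (by decide)
  have howner : findBest.exec σ ownerA = σ ownerA := Cmd.exec_apply_of_writes _ (by decide)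
  have hobject : findBest.exec σ objectA = σ objectA := Cmd.exec_apply_of_writes _ (by decide)
  have hi' : findBest.exec σ iA = σ iA := Cmd.exec_apply_of_writes _ (by decide)
  have key := hA.bid (weight_le D) hfree hbest
  have e1 : placeBid.exec σ priceA = Function.update (σ priceA) j (σ priceA j + 1) := by
    simp only [placeBid, Cmd.exec_block_cons, Cmd.exec_block_nil, Cmd.exec_ite]
    split_ifs <;> simp [Store.write_array, hprice, hj]
  have e2 : placeBid.exec σ ownerA = Function.update (σ ownerA) j (i + 1) := by
    simp only [placeBid, Cmd.exec_block_cons, Cmd.exec_block_nil, Cmd.exec_ite]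
    split_ifs <;> simp [Store.write_array, howner, hj, hi', hi]
  have e3 : placeBid.exec σ objectA = Function.update
      (if σ ownerA j ≠ 0 then Function.update (σ objectA) (σ ownerA j - 1) 0 else σ objectA) i
        (j + 1) := by
    simp only [placeBid, Cmd.exec_block_cons, Cmd.exec_block_nil, Cmd.exec_ite, Cmd.exec_assign,
      Cmd.exec_skip]
    have hcond : (Expr.read ownerA (.reg bestA)).eval ((findBest.exec σ).write priceA
        ((Expr.reg bestA).eval (findBest.exec σ))
        ((Expr.add (.read priceA (.reg bestA)) (.const 1)).eval (findBest.exec σ))) =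
        σ ownerA j := by
      simp [howner, hj]
    rw [hcond]
    split_ifs <;> simp [Store.write_array, howner, hobject, hj, hi', hi]
  refine ⟨⟨hE.exec placeBid (by decide), ?_⟩, ?_⟩
  · rw [e1, e2, e3]
    exact key
  · rw [e1]
    have : ∀ l : Fin n, Function.update (σ priceA) j (σ priceA j + 1) l =
        σ priceA l + if l = j then 1 else 0 := by
      intro l
      by_cases hl : l = j
      · subst hl; simp
      · rw [Function.update_of_ne fun e => hl (Fin.ext e), if_neg hl, add_zero]
    simp [this, Finset.sum_add_distrib]

/-- Either everybody has an object, or the prices have reached the sum `m`. -/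
def AuctionProgress (D : Digraph (Fin n)) (m : ℕ) (σ : Store) : Prop :=
  IsAuction D σ ∧ ((∀ i : Fin n, σ objectA i ≠ 0) ∨ m ≤ ∑ j : Fin n, σ priceA j)

theorem AuctionProgress.write {m : ℕ} (h : AuctionProgress D m σ) {a : ℕ}
    (ha : a ∉ [0, 1, rowA, loA, hiA, priceA, ownerA, objectA]) (i v : ℕ) :
    AuctionProgress D m (σ.write a i v) := by
  have he : ∀ b ∈ [0, 1, rowA, loA, hiA, priceA, ownerA, objectA], σ.write a i v b = σ b :=
    fun b hb => Store.write_of_ne _ _ _ fun e => ha (e ▸ hb)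
  refine ⟨h.1.congr he, ?_⟩
  rw [he priceA (by decide), he objectA (by decide)]
  exact h.2

theorem exec_auctionRound {m : ℕ} (h : AuctionProgress D m σ) :
    AuctionProgress D (m + 1) (auctionRound.exec σ) := by
  have key := Cmd.exec_loop_zero_induction (c := iA)
    (p := .ite (.read objectA (.reg iA)) .skip placeBid) h.1.1.size
    (fun i τ => AuctionProgress D (m + 1) τ ∨
      AuctionProgress D m τ ∧ ∀ i' : Fin n, i' < i → τ objectA i' ≠ 0) ?_ ?_
  · rcases key with key | key
    · exact key
    · exact ⟨key.1.1, .inl fun i => key.2 i i.2⟩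
  · exact .inr ⟨h.write (by decide) _ _, fun i hi => absurd hi (Nat.not_lt_zero _)⟩
  · intro i τ hi hc hf ih
    have heval : (Expr.read objectA (.reg iA)).eval τ = τ objectA i := by simp [hc]
    rw [Cmd.exec_ite, heval]
    split_ifs with hobj
    · rw [Cmd.exec_skip]
      rcases ih with ih | ⟨ih, hall⟩
      · exact .inl (ih.write (by decide) _ _)
      · refine .inr ⟨ih.write (by decide) _ _, fun i' hi' => ?_⟩
        rw [Store.write_of_ne _ _ _ (by decide)]
        rcases Nat.lt_succ_iff_lt_or_eq.1 hi' with hi' | hi'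
        · exact hall i' hi'
        · rwa [hi']
    · rw [not_not] at hobj
      have hprog : AuctionProgress D m τ := by
        rcases ih with ih | ih
        · exact ⟨ih.1, ih.2.imp_right (by omega)⟩
        · exact ih.1
      obtain ⟨h1, h2⟩ := exec_placeBid hprog.1 (i := ⟨i, hi⟩) hc hobj
      refine .inl (AuctionProgress.write ⟨h1, .inr ?_⟩ (by decide) _ _)
      rw [h2]
      exact Nat.succ_le_succ (hprog.2.resolve_left fun hall => hall ⟨i, hi⟩ hobj)

theorem exec_loop_auctionProgress {c k s : ℕ} {p : Cmd}
    (hc : c ∉ [0, 1, rowA, loA, hiA, priceA, ownerA, objectA])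
    (hp : ∀ m σ, AuctionProgress D m σ → AuctionProgress D (m + s) (p.exec σ)) {m : ℕ}
    (h : AuctionProgress D m σ) :
    AuctionProgress D (m + (n + k) * s) ((Cmd.loop c k p).exec σ) := by
  have key := Cmd.exec_loop_induction (c := c) (k := k) (p := p) (σ := σ)
    (fun i τ => AuctionProgress D (m + i * s) τ) (by simpa using h.write hc _ _) ?_
  · rwa [h.1.1.size] at key
  · intro i τ _ _ _ ih
    rw [Nat.succ_mul, ← add_assoc]
    exact (hp _ _ ih).write hc _ _

theorem exec_auction (h : AuctionProgress D 0 σ) :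
    IsAuction D (auction.exec σ) ∧ ∀ i : Fin n, auction.exec σ objectA i ≠ 0 := by
  have key : AuctionProgress D (0 + (n + 3) * ((n + 3) * ((n + 3) * 1))) (auction.exec σ) :=
    exec_loop_auctionProgress (by decide) (fun _ _ => exec_loop_auctionProgress (by decide)
      fun _ _ => exec_loop_auctionProgress (by decide) fun _ _ => exec_auctionRound) h
  refine ⟨key.1, key.2.resolve_right fun hle => ?_⟩
  have hsum : ∑ j : Fin n, auction.exec σ priceA j ≤ ∑ _j : Fin n, (hiWeight n + 1) :=
    Finset.sum_le_sum fun j _ => key.1.2.price_le j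
  simp only [Finset.sum_const, Finset.card_univ, Fintype.card_fin, smul_eq_mul, hiWeight] at hsum
  nlinarith

end RAM

/-! ### The search for exchanges -/

namespace RAM

open Equiv

/-- the current permutation -/
abbrev permA : ℕ := 20
/-- a candidate for the next permutation -/
abbrev candA : ℕ := 21
/-- the total weight of the candidate -/
abbrev sumA : ℕ := 22
/-- the length of the cycle of `0` in the candidate -/
abbrev lenA : ℕ := 23
/-- the total weight of the permutation that the auction yields -/
abbrev goalSumA : ℕ := 24
/-- the length of the cycle of `0` in the current permutation -/
abbrev permLenA : ℕ := 25
/-- the current point on the cycle of `0` -/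
abbrev curA : ℕ := 26
/-- whether the walk along the cycle of `0` has not yet returned to `0` -/
abbrev flagA : ℕ := 27
/-- auxiliary register for swaps -/
abbrev tmpA : ℕ := 28
/-- loop counters -/
abbrev aA : ℕ := 30
/-- loop counters -/
abbrev bA : ℕ := 31
/-- loop counters -/
abbrev cA : ℕ := 32
/-- loop counters -/
abbrev dA : ℕ := 33

/-- Copy the first `n` registers of the array `a` to the array `b`. -/
def copy (a b : ℕ) : Cmd := .loop iA 0 (.assign b (.reg iA) (.read a (.reg iA)))

/-- Exchange the successors of the vertices in `x` and `y`. -/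
def swapCand (x y : ℕ) : Cmd := .block [
  .set tmpA (.read candA (.reg x)),
  .assign candA (.reg x) (.read candA (.reg y)),
  .assign candA (.reg y) (.reg tmpA)]

/-- Compute the total weight of the candidate. -/
def computeSum : Cmd := .block [
  .set sumA (.const 0),
  .loop iA 0 (.block [
    weigh (.reg iA) (.read candA (.reg iA)),
    .set sumA (.add (.reg sumA) (.reg wA))])]

/-- Compute the length of the cycle of `0` in the candidate. -/
def computeLen : Cmd := .block [
  .set curA (.const 0),
  .set flagA (.const 1),
  .set lenA (.const 0),
  .loop iA 0 (.block [
    .set lenA (.add (.reg lenA) (.reg flagA)),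
    .set curA (.read candA (.reg curA)),
    .ite (.reg curA) .skip (.set flagA (.const 0))])]

/-- The candidate becomes the current permutation. -/
def adopt : Cmd := .block [copy candA permA, .set permLenA (.reg lenA)]

/-- Try the exchange on the vertices in `aA`, `bA`, `cA`, `dA`. -/
def tryExchange : Cmd := .block [
  copy permA candA, swapCand aA bA, swapCand bA cA, swapCand cA dA, computeSum, computeLen,
  .ite (.sub (.reg lenA) (.reg permLenA))
    (.ite (.sub (.reg goalSumA) (.reg sumA)) .skip adopt) .skip]

/-- Try all exchanges, `n` times. -/
def search : Cmd := .loop rA 0 (.loop aA 0 (.loop bA 0 (.loop cA 0 (.loop dA 0 tryExchange))))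

variable {n : ℕ} {D : Digraph (Fin n)} {σ τ : Store} {π ρ : Perm (Fin n)}

/-- The array `a` holds the permutation `π`. -/
def HoldsPerm (a : ℕ) (π : Perm (Fin n)) (σ : Store) : Prop := ∀ i : Fin n, σ a i = π i

theorem exec_copy (hn : σ 0 0 = n) {a b : ℕ} (hab : a ≠ b) (ha : a ≠ iA) (hb : b ≠ iA) :
    ∀ i : Fin n, (copy a b).exec σ b i = σ a i := by
  have key := Cmd.exec_loop_zero_induction (c := iA)
    (p := .assign b (.reg iA) (.read a (.reg iA))) hn
    (fun m τ => ∀ i : Fin n, i < m → τ b i = σ a i) (fun i hi => absurd hi (Nat.not_lt_zero _)) ?_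
  · exact fun i => key i i.2
  · intro m τ hm hc hf ih i hi
    have hτ : τ a = σ a := hf a (by simp [Cmd.writes, ha, hab])
    rw [Store.write_of_ne _ _ _ hb]
    simp only [Cmd.exec_assign, Expr.eval, hc, Store.write_same_apply]
    split_ifs with him
    · rw [hτ, him]
    · exact ih i (by omega)

theorem exec_swapCand {x y : ℕ} {u v : Fin n} (hσ : HoldsPerm candA ρ σ) (hx : σ x 0 = u)
    (hy : σ y 0 = v) (hx1 : x ∉ [candA, tmpA]) (hy1 : y ∉ [candA, tmpA]) :
    HoldsPerm candA (ρ * swap u v) ((swapCand x y).exec σ) := by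
  simp only [List.mem_cons, List.not_mem_nil, or_false, not_or] at hx1 hy1
  intro i
  simp [swapCand, hx1.2, hy1.1, hy1.2, hx, hy, Store.write_same_apply, hσ u, hσ v, hσ i,
    Fin.val_inj, swap_apply_def]
  split_ifs <;> simp_all

theorem exec_computeSum (hE : Env D σ) (hσ : HoldsPerm candA ρ σ) :
    computeSum.exec σ sumA 0 = ∑ i, weight D i (ρ i) := by
  let f : ℕ → ℕ := fun i => if h : i < n then weight D ⟨i, h⟩ (ρ ⟨i, h⟩) else 0
  have hn : ((Cmd.set sumA (.const 0)).exec σ) 0 0 = n := by simp [hE.size]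
  have key := Cmd.exec_loop_zero_induction (c := iA) (p := .block [
    weigh (.reg iA) (.read candA (.reg iA)), .set sumA (.add (.reg sumA) (.reg wA))]) hn
    (fun m τ => τ sumA 0 = ∑ i ∈ Finset.range m, f i) (by simp) ?_
  · refine Eq.trans key ?_
    rw [Finset.sum_range]
    simp [f]
  · intro m τ hm hc hf ih
    have hE' : Env D τ := hE.congr fun a ha => by
      rw [hf a (by revert a; decide)]
      exact Store.write_of_ne _ _ _ (by rintro rfl; revert ha; decide)
    have hcand : τ candA = σ candA := by rw [hf candA (by decide)]; simp
    have e1 := exec_weigh hE' (x := .reg iA) (y := .read candA (.reg iA)) (i := ⟨m, hm⟩)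
      (j := ρ ⟨m, hm⟩) hc (by simpa [hc, hcand] using hσ ⟨m, hm⟩)
    simp [e1, ih, Finset.sum_range_succ, f, hm]

variable [NeZero n]

theorem minimalPeriod_pos (ρ : Perm (Fin n)) : 0 < Function.minimalPeriod ρ 0 := by
  rw [Perm.minimalPeriod_eq_ncard, Set.ncard_pos]
  exact ⟨0, Perm.SameCycle.refl _ _⟩

theorem minimalPeriod_le (ρ : Perm (Fin n)) : Function.minimalPeriod ρ 0 ≤ n := by
  rw [Perm.minimalPeriod_eq_ncard]
  simpa using Set.ncard_le_card {y | ρ.SameCycle 0 y}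

theorem exec_computeLen (hn : σ 0 0 = n) (hσ : HoldsPerm candA ρ σ) :
    computeLen.exec σ lenA 0 = Function.minimalPeriod ρ 0 := by
  have hpos := minimalPeriod_pos ρ
  simp only [computeLen, Cmd.exec_block_cons, Cmd.exec_block_nil]
  set σ' := (Cmd.set lenA (.const 0)).exec ((Cmd.set flagA (.const 1)).exec
    ((Cmd.set curA (.const 0)).exec σ)) with hσ'
  have hn' : σ' 0 0 = n := by simp [hσ', hn]
  have key := Cmd.exec_loop_zero_induction (c := iA) (p := .block [
    .set lenA (.add (.reg lenA) (.reg flagA)),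
    .set curA (.read candA (.reg curA)),
    .ite (.reg curA) .skip (.set flagA (.const 0))]) hn'
    (fun m τ => τ curA 0 = (ρ^[m] 0 : Fin n) ∧ τ lenA 0 = min m (Function.minimalPeriod ρ 0) ∧
      τ flagA 0 = if m < Function.minimalPeriod ρ 0 then 1 else 0) (by simp [hσ', hpos]) ?_
  · rw [key.2.1, min_eq_right (minimalPeriod_le ρ)]
  · rintro m τ hm hc hf ⟨h1, h2, h3⟩
    have hcand : τ candA = σ candA := by rw [hf candA (by decide)]; simp [hσ']
    have hnext : σ candA (ρ^[m] 0 : Fin n) = (ρ^[m + 1] 0 : Fin n) := by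
      rw [hσ, Function.iterate_succ_apply']
    have hlen : min m (Function.minimalPeriod ρ 0) +
        (if m < Function.minimalPeriod ρ 0 then 1 else 0) =
        min (m + 1) (Function.minimalPeriod ρ 0) := by
      split_ifs <;> omega
    by_cases h0 : (ρ^[m + 1] 0 : Fin n) = 0
    · have hle : Function.minimalPeriod ρ 0 ≤ m + 1 :=
        Function.IsPeriodicPt.minimalPeriod_le (Nat.succ_pos m) h0
      simp [h1, h2, h3, hcand, hnext, hlen, h0, hle, -Function.iterate_succ]
    · have hne : m + 1 ≠ Function.minimalPeriod ρ 0 := by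
        rintro e
        rw [e] at h0
        exact h0 (Function.isPeriodicPt_minimalPeriod ρ 0)
      have hiff : m + 1 < Function.minimalPeriod ρ 0 ↔ m < Function.minimalPeriod ρ 0 := by omega
      simp [h1, h2, h3, hcand, hnext, hlen, h0, hiff, -Function.iterate_succ]

/-- The memory during the search: the current permutation `π` is of total weight at least `M`. -/
structure SearchState (D : Digraph (Fin n)) (M : ℕ) (π : Perm (Fin n)) (σ : Store) : Prop where
  env : Env D σ
  perm : HoldsPerm permA π σ
  len : σ permLenA 0 = Function.minimalPeriod π 0
  goal : σ goalSumA 0 = M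
  le_sum : M ≤ ∑ i, weight D i (π i)

/-- The arrays on which `SearchState` depends. -/
abbrev searchArrays : List ℕ := [0, 1, rowA, loA, hiA, permA, permLenA, goalSumA]

variable {M : ℕ}

theorem SearchState.congr (h : SearchState D M π σ) (he : ∀ a ∈ searchArrays, τ a = σ a) :
    SearchState D M π τ where
  env := h.env.congr fun a ha => he a (by revert a; decide)
  perm i := by rw [he permA (by decide)]; exact h.perm i
  len := by rw [he permLenA (by decide)]; exact h.len
  goal := by rw [he goalSumA (by decide)]; exact h.goal
  le_sum := h.le_sum

theorem SearchState.write (h : SearchState D M π σ) {a : ℕ} (ha : a ∉ searchArrays) (i v : ℕ) :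
    SearchState D M π (σ.write a i v) :=
  h.congr fun _ hb => Store.write_of_ne _ _ _ fun e => ha (e ▸ hb)

/-- The tests that a candidate `ρ` has to pass to replace `π`. -/
def Improves (D : Digraph (Fin n)) (M : ℕ) (π ρ : Perm (Fin n)) : Prop :=
  M ≤ ∑ i, weight D i (ρ i) ∧ Function.minimalPeriod π 0 < Function.minimalPeriod ρ 0

theorem exec_tryExchange (h : SearchState D M π σ) {a b c d : Fin n} (ha : σ aA 0 = a)
    (hb : σ bA 0 = b) (hc : σ cA 0 = c) (hd : σ dA 0 = d) :
    ∃ π', SearchState D M π' (tryExchange.exec σ) ∧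
      (Function.minimalPeriod π 0 < Function.minimalPeriod π' 0 ∨
        π' = π ∧ ¬ Improves D M π (π.exchange a b c d)) := by
  simp only [tryExchange, Cmd.exec_block_cons, Cmd.exec_block_nil, Cmd.exec_ite, Cmd.exec_skip]
  set σ₁ := (copy permA candA).exec σ with hσ₁
  set σ₂ := (swapCand aA bA).exec σ₁ with hσ₂
  set σ₃ := (swapCand bA cA).exec σ₂ with hσ₃
  set σ₄ := (swapCand cA dA).exec σ₃ with hσ₄
  set σ₅ := computeSum.exec σ₄ with hσ₅
  set σ₆ := computeLen.exec σ₅ with hσ₆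
  have f₁ : ∀ x ∈ [aA, bA, cA, dA], σ₁ x = σ x := fun x hx =>
    Cmd.exec_apply_of_writes _ (by revert x; decide)
  have f₂ : ∀ x ∈ [aA, bA, cA, dA], σ₂ x = σ₁ x := fun x hx =>
    Cmd.exec_apply_of_writes _ (by revert x; decide)
  have f₃ : ∀ x ∈ [aA, bA, cA, dA], σ₃ x = σ₂ x := fun x hx =>
    Cmd.exec_apply_of_writes _ (by revert x; decide)
  have h₁ : HoldsPerm candA π σ₁ := fun i =>
    (exec_copy h.env.size (by decide) (by decide) (by decide) i).trans (h.perm i)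
  have h₂ : HoldsPerm candA (π * swap a b) σ₂ :=
    exec_swapCand h₁ (by rw [f₁ _ (by decide), ha]) (by rw [f₁ _ (by decide), hb]) (by decide)
      (by decide)
  have h₃ : HoldsPerm candA (π * swap a b * swap b c) σ₃ :=
    exec_swapCand h₂ (by rw [f₂ _ (by decide), f₁ _ (by decide), hb])
      (by rw [f₂ _ (by decide), f₁ _ (by decide), hc]) (by decide) (by decide)
  have h₄ : HoldsPerm candA (π.exchange a b c d) σ₄ :=
    exec_swapCand h₃ (by rw [f₃ _ (by decide), f₂ _ (by decide), f₁ _ (by decide), hc])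
      (by rw [f₃ _ (by decide), f₂ _ (by decide), f₁ _ (by decide), hd]) (by decide) (by decide)
  have S₆ : SearchState D M π σ₆ := h.congr fun x hx => by
    rw [hσ₆, Cmd.exec_apply_of_writes _ (by revert x; decide), hσ₅,
      Cmd.exec_apply_of_writes _ (by revert x; decide), hσ₄,
      Cmd.exec_apply_of_writes _ (by revert x; decide), hσ₃,
      Cmd.exec_apply_of_writes _ (by revert x; decide), hσ₂,
      Cmd.exec_apply_of_writes _ (by revert x; decide), hσ₁,
      Cmd.exec_apply_of_writes _ (by revert x; decide)]
  have E₄ : Env D σ₄ := h.env.congr fun x hx => by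
    rw [hσ₄, Cmd.exec_apply_of_writes _ (by revert x; decide), hσ₃,
      Cmd.exec_apply_of_writes _ (by revert x; decide), hσ₂,
      Cmd.exec_apply_of_writes _ (by revert x; decide), hσ₁,
      Cmd.exec_apply_of_writes _ (by revert x; decide)]
  have h₅ : HoldsPerm candA (π.exchange a b c d) σ₅ := fun i => by
    rw [hσ₅, Cmd.exec_apply_of_writes _ (by decide)]; exact h₄ i
  have h₆ : HoldsPerm candA (π.exchange a b c d) σ₆ := fun i => by
    rw [hσ₆, Cmd.exec_apply_of_writes _ (by decide)]; exact h₅ i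
  have hsum : σ₆ sumA 0 = ∑ i, weight D i (π.exchange a b c d i) := by
    rw [hσ₆, Cmd.exec_apply_of_writes _ (by decide)]
    exact exec_computeSum E₄ h₄
  have hlen : σ₆ lenA 0 = Function.minimalPeriod (π.exchange a b c d) 0 :=
    exec_computeLen (E₄.exec computeSum (by decide)).size h₅
  simp only [Expr.eval, S₆.len, S₆.goal, hsum, hlen]
  split_ifs with c₁ c₂
  · exact ⟨π, S₆, .inr ⟨rfl, fun hi => by have := hi.1; omega⟩⟩
  · refine ⟨π.exchange a b c d, ⟨S₆.env.exec adopt (by decide), fun i => ?_, ?_, ?_, by omega⟩,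
      .inl (by omega)⟩
    · have e : (copy candA permA).exec σ₆ permA i = σ₆ candA i :=
        exec_copy S₆.env.size (by decide) (by decide) (by decide) i
      have e' : adopt.exec σ₆ permA = (copy candA permA).exec σ₆ permA := by
        simp [adopt]
      rw [e', e, h₆]
    · have e : (copy candA permA).exec σ₆ lenA = σ₆ lenA :=
        Cmd.exec_apply_of_writes _ (by decide)
      simp [adopt, e, hlen]
    · rw [Cmd.exec_apply_of_writes _ (by decide), S₆.goal]
  · exact ⟨π, S₆, .inr ⟨rfl, fun hi => by have := hi.2; omega⟩⟩

/-- If the body tries one exchange for each value of the counter, then the loop either finds an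
improvement or shows that all these exchanges fail for the initial permutation. -/
theorem exec_loop_search {c : ℕ} {p : Cmd} (hc : c ∉ searchArrays)
    (F : Fin n → Perm (Fin n) → Prop)
    (hp : ∀ τ (i : Fin n) π, (∀ a, (Cmd.loop c 0 p).writes a = false → τ a = σ a) → τ c 0 = i.val →
      SearchState D M π τ → ∃ π', SearchState D M π' (p.exec τ) ∧
        (Function.minimalPeriod π 0 < Function.minimalPeriod π' 0 ∨ π' = π ∧ F i π))
    (h : SearchState D M π σ) :
    ∃ π', SearchState D M π' ((Cmd.loop c 0 p).exec σ) ∧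
      (Function.minimalPeriod π 0 < Function.minimalPeriod π' 0 ∨ π' = π ∧ ∀ i, F i π) := by
  have key := Cmd.exec_loop_zero_induction (c := c) (p := p) h.env.size
    (fun m τ => ∃ π', SearchState D M π' τ ∧
      (Function.minimalPeriod π 0 < Function.minimalPeriod π' 0 ∨
        π' = π ∧ ∀ i : Fin n, i < m → F i π))
    ⟨π, h.write hc _ _, .inr ⟨rfl, fun i hi => absurd hi (Nat.not_lt_zero _)⟩⟩ ?_
  · obtain ⟨π', h', hπ'⟩ := key
    exact ⟨π', h', hπ'.imp_right fun hF => ⟨hF.1, fun i => hF.2 i i.2⟩⟩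
  · rintro m τ hm hctr hf ⟨π₁, h₁, hπ₁⟩
    obtain ⟨π₂, h₂, hπ₂⟩ := hp τ ⟨m, hm⟩ π₁ hf hctr h₁
    refine ⟨π₂, h₂.write hc _ _, ?_⟩
    rcases hπ₁ with hlt | ⟨rfl, hF⟩
    · rcases hπ₂ with hlt' | ⟨rfl, -⟩
      · exact .inl (hlt.trans hlt')
      · exact .inl hlt
    · refine hπ₂.imp_right fun hF' => ⟨hF'.1, fun i hi => ?_⟩
      rcases Nat.lt_succ_iff_lt_or_eq.1 hi with hi | hi
      · exact hF i hi
      · obtain rfl : i = ⟨m, hm⟩ := Fin.ext hi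
        exact hF'.2

theorem exec_search {P : Setoid (Fin n)} (hD : D.IsExtendedSemicomplete P) (hs : D.IsStrong)
    (h : SearchState D M π σ) :
    ∃ π', SearchState D M π' (search.exec σ) ∧ Function.minimalPeriod π' 0 = n := by
  have round : ∀ τ π, SearchState D M π τ →
      ∃ π', SearchState D M π'
        ((Cmd.loop aA 0 (.loop bA 0 (.loop cA 0 (.loop dA 0 tryExchange)))).exec τ) ∧
        (Function.minimalPeriod π 0 < Function.minimalPeriod π' 0 ∨
          π' = π ∧ ∀ a b c d, ¬ Improves D M π (π.exchange a b c d)) := by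
    intro τ π h
    refine exec_loop_search (by decide)
      (fun a π => ∀ b c d, ¬ Improves D M π (π.exchange a b c d)) ?_ h
    intro τ₁ a π₁ _ ha h₁
    refine exec_loop_search (by decide)
      (fun b π => ∀ c d, ¬ Improves D M π (π.exchange a b c d)) ?_ h₁
    intro τ₂ b π₂ f₂ hb h₂
    refine exec_loop_search (by decide)
      (fun c π => ∀ d, ¬ Improves D M π (π.exchange a b c d)) ?_ h₂
    intro τ₃ c π₃ f₃ hc h₃
    refine exec_loop_search (by decide)
      (fun d π => ¬ Improves D M π (π.exchange a b c d)) ?_ h₃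
    intro τ₄ d π₄ f₄ hd h₄
    refine exec_tryExchange h₄ ?_ ?_ ?_ hd
    · rw [f₄ _ (by decide), f₃ _ (by decide), f₂ _ (by decide), ha]
    · rw [f₄ _ (by decide), f₃ _ (by decide), hb]
    · rw [f₄ _ (by decide), hc]
  have key := Cmd.exec_loop_zero_induction (c := rA)
    (p := .loop aA 0 (.loop bA 0 (.loop cA 0 (.loop dA 0 tryExchange)))) h.env.size
    (fun m τ => ∃ π', SearchState D M π' τ ∧ m ≤ Function.minimalPeriod π' 0)
    ⟨π, h.write (by decide) _ _, Nat.zero_le _⟩ ?_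
  · obtain ⟨π', h', hle⟩ := key
    exact ⟨π', h', (minimalPeriod_le π').antisymm hle⟩
  · rintro m τ hm _ _ ⟨π₁, h₁, hle⟩
    obtain ⟨π₂, h₂, hπ₂⟩ := round τ π₁ h₁
    refine ⟨π₂, h₂.write (by decide) _ _, ?_⟩
    rcases hπ₂ with hlt | ⟨rfl, hF⟩
    · omega
    by_contra hlt
    have ho : ∃ x, ¬ π₂.SameCycle 0 x := by
      by_contra! hall
      have huniv : {y | π₂.SameCycle 0 y} = Set.univ := Set.eq_univ_of_forall hall
      rw [Perm.minimalPeriod_eq_ncard, huniv, Set.ncard_univ, Nat.card_fin] at hlt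
      omega
    obtain ⟨a, b, c, d, hle', hlt'⟩ := hD.exists_exchange hs (W := weight D)
      (fun u v w huv => by
        rw [weight, weight, propext (hD.adj_left_iff w huv), propext (hD.adj_right_iff w huv)])
      (fun u v x y huv => by
        rw [weight.eq_def D u v, if_pos huv]
        exact weight_le D x y) ho
    exact hF a b c d ⟨h₂.le_sum.trans hle', hlt'⟩

end RAM

/-! ### Spanning G-cycles and permutations -/

section GCycle

variable {V : Type*} {D : Digraph V} {P : Setoid V} {π : Equiv.Perm V} {c : List V}

theorem cyclicPairs_eq_map (h : c.rotate 1 = c.map π) :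
    cyclicPairs c = c.map fun v => (v, π v) := by
  rw [cyclicPairs, h]
  exact (congrArg (List.zip · (c.map π)) c.map_id.symm).trans List.zip_map'

theorem List.Nodup.rotate_one_eq_map_formPerm [DecidableEq V] (h : c.Nodup) :
    c.rotate 1 = c.map c.formPerm := by
  refine List.ext_getElem (by simp) fun i h₁ h₂ => ?_
  rw [List.getElem_rotate, List.getElem_map, List.formPerm_apply_getElem c h]

variable [Fintype V]

open Classical in
theorem Digraph.gLength_eq_card (hrot : c.rotate 1 = c.map π) (hnodup : c.Nodup)
    (hspan : ∀ v, v ∈ c) : D.gLength c = Finset.card {v | D.Adj v (π v)} := by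
  rw [Digraph.gLength, cyclicPairs_eq_map hrot, List.countP_map, List.countP_eq_length_filter,
    ← List.toFinset_card_of_nodup (hnodup.filter _)]
  congr 1
  ext v
  simp [hspan v]

open Classical in
/-- The successor function of a spanning G-cycle. -/
theorem Digraph.IsSpanningGCycle.exists_perm (hc : D.IsSpanningGCycle P c) :
    ∃ π : Equiv.Perm V, (∀ v, D.Adj v (π v) ∨ P v (π v)) ∧
      D.gLength c = Finset.card {v | D.Adj v (π v)} := by
  have hrot := hc.1.nodup.rotate_one_eq_map_formPerm
  refine ⟨c.formPerm, fun v => ?_, Digraph.gLength_eq_card hrot hc.1.nodup hc.2⟩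
  refine hc.1.arc_or_same (v, c.formPerm v) ?_
  rw [cyclicPairs_eq_map hrot]
  exact List.mem_map_of_mem (hc.2 v)

end GCycle

section

variable {n : ℕ} [NeZero n] {π : Equiv.Perm (Fin n)}

/-- The cycle of `0`. -/
def cycleList (π : Equiv.Perm (Fin n)) : List (Fin n) := List.ofFn fun k : Fin n => π^[k] 0

theorem injective_iterate (hπ : Function.minimalPeriod π 0 = n) :
    Function.Injective fun k : Fin n => π^[k] 0 := by
  intro k l hkl
  refine Fin.ext (Function.iterate_injOn_Iio_minimalPeriod (f := π) (x := 0) ?_ ?_ hkl) <;>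
    simp [hπ]

theorem rotate_cycleList (hπ : Function.minimalPeriod π 0 = n) :
    (cycleList π).rotate 1 = (cycleList π).map π := by
  refine List.ext_getElem (by simp) fun i h₁ h₂ => ?_
  have h := Function.iterate_mod_minimalPeriod_eq (f := π) (x := 0) (n := i + 1)
  rw [hπ] at h
  simp only [cycleList, List.getElem_rotate, List.getElem_map, List.getElem_ofFn, List.length_ofFn]
  rw [h, Function.iterate_succ_apply']

theorem isSpanningGCycle_cycleList {D : Digraph (Fin n)} {P : Setoid (Fin n)}
    (hπ : Function.minimalPeriod π 0 = n) (h : ∀ v, D.Adj v (π v) ∨ P v (π v)) :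
    D.IsSpanningGCycle P (cycleList π) := by
  refine ⟨⟨?_, List.nodup_ofFn.2 (injective_iterate hπ), ?_⟩, fun v => ?_⟩
  · exact List.ne_nil_of_length_pos (by simpa [cycleList] using Nat.pos_of_neZero n)
  · intro p hp
    rw [cyclicPairs_eq_map (rotate_cycleList hπ)] at hp
    obtain ⟨v, -, rfl⟩ := List.mem_map.1 hp
    exact h v
  · obtain ⟨k, hk⟩ := Finite.surjective_of_injective (injective_iterate hπ) v
    exact List.mem_ofFn.2 ⟨k, hk⟩

end

namespace RAM

open Equiv

variable {n : ℕ} {D : Digraph (Fin n)} {P : Setoid (Fin n)} {π : Perm (Fin n)} {σ : Store}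

open Classical in
theorem sum_weight (hD : D.IsExtendedSemicomplete P) (h : ∀ v, D.Adj v (π v) ∨ P v (π v)) :
    ∑ i, weight D i (π i) =
      n * loWeight n + (n + 1) * Finset.card {v | D.Adj v (π v)} := by
  have hW : ∀ i, weight D i (π i) = loWeight n + if D.Adj i (π i) then n + 1 else 0 := by
    intro i
    rw [weight]
    by_cases ha : D.Adj i (π i)
    · simp [ha, hiWeight, loWeight]
    · have := (hD.rel_iff.1 ((h i).resolve_left ha)).2
      simp [ha, this]
  simp only [hW, Finset.sum_add_distrib, Finset.sum_const, Finset.card_univ, Fintype.card_fin,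
    smul_eq_mul, ← Finset.sum_filter]
  ring

/-- A total weight that is at most `n` below the largest one is that of a permutation whose steps
are all allowed: the identity is better than a permutation with a step of weight `0`. -/
theorem adj_or_rel_of_sum_weight (hD : D.IsExtendedSemicomplete P)
    (h : ∀ ρ : Perm (Fin n), ∑ i, weight D i (ρ i) ≤ ∑ i, weight D i (π i) + n) (v : Fin n) :
    D.Adj v (π v) ∨ P v (π v) := by
  by_contra hv
  have h0 : weight D v (π v) = 0 := by
    rw [not_or, hD.rel_iff] at hv
    rw [weight, if_neg hv.1, if_pos (by tauto)]
  have hid : n * loWeight n ≤ ∑ i, weight D i (π i) + n := by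
    refine le_trans ?_ (h 1)
    rw [sum_weight hD fun v => .inr (P.refl' v)]
    exact Nat.le_add_right _ _
  have hsum : ∑ i, (weight D i (π i) + if i = v then hiWeight n else 0) ≤
      ∑ _i : Fin n, hiWeight n := by
    refine Finset.sum_le_sum fun i _ => ?_
    split_ifs with hi
    · rw [hi, h0, zero_add]
    · exact weight_le D i (π i)
  simp only [Finset.sum_add_distrib, Finset.sum_ite_eq', Finset.mem_univ, if_true, Finset.sum_const,
    Finset.card_univ, Fintype.card_fin, smul_eq_mul] at hsum
  simp only [loWeight, hiWeight] at hid hsum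
  nlinarith

open Classical in
/-- Such a permutation has the largest number of arcs, since an arc contributes more than `n`. -/
theorem card_le_of_sum_weight (hD : D.IsExtendedSemicomplete P)
    (h : ∀ ρ : Perm (Fin n), ∑ i, weight D i (ρ i) ≤ ∑ i, weight D i (π i) + n)
    {ρ : Perm (Fin n)} (hρ : ∀ v, D.Adj v (ρ v) ∨ P v (ρ v)) :
    Finset.card {v | D.Adj v (ρ v)} ≤ Finset.card {v | D.Adj v (π v)} := by
  have := h ρ
  rw [sum_weight hD hρ, sum_weight hD (adj_or_rel_of_sum_weight hD h)] at this
  by_contra! hlt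
  have := Nat.mul_le_mul_left (n + 1) (Nat.succ_le_of_lt hlt)
  rw [Nat.mul_succ] at this
  omega

/-! ### The algorithm -/

/-- The objects of the auction become the successors, and the registers of the search are set. -/
def prepareSearch : Cmd := .block [
  .loop iA 0 (.assign permA (.reg iA) (.sub (.read objectA (.reg iA)) (.const 1))),
  copy permA candA, computeSum, computeLen,
  .set goalSumA (.reg sumA), .set permLenA (.reg lenA)]

/-- Write the cycle of `0`. -/
def outputCycle : Cmd := .block [
  .set curA (.const 0),
  .loop iA 0 (.block [
    .assign 3 (.reg iA) (.reg curA),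
    .set curA (.read permA (.reg curA))])]

/-- The answer is yes on all digraphs but the empty one. -/
def algorithm : Cmd := .block [
  setup, auction, prepareSearch, search, outputCycle,
  .ite (.reg 0) (.set 2 (.const 1)) .skip]

theorem isAuction_setup (D : Digraph (Fin n)) : IsAuction D (setup.exec (inputDigraph D)) := by
  have h0 : ∀ a, 2 ≤ a → setup.writes a = false → setup.exec (inputDigraph D) a = 0 := by
    intro a ha hw
    rw [Cmd.exec_apply_of_writes _ hw]
    funext k
    simp [inputDigraph, show a ≠ 0 by omega, show a ≠ 1 by omega]
  refine ⟨env_setup D, ?_⟩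
  rw [h0 priceA (by decide) (by decide), h0 ownerA (by decide) (by decide),
    h0 objectA (by decide) (by decide)]
  exact AuctionInv.init _ _

variable [NeZero n]

theorem exec_prepareSearch (hE : Env D σ) (hσ : ∀ i : Fin n, σ objectA i = π i + 1) :
    SearchState D (∑ i, weight D i (π i)) π (prepareSearch.exec σ) := by
  simp only [prepareSearch, Cmd.exec_block_cons, Cmd.exec_block_nil]
  set σ₁ := (Cmd.loop iA 0
    (.assign permA (.reg iA) (.sub (.read objectA (.reg iA)) (.const 1)))).exec σ with hσ₁
  set σ₂ := (copy permA candA).exec σ₁ with hσ₂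
  set σ₃ := computeSum.exec σ₂ with hσ₃
  set σ₄ := computeLen.exec σ₃ with hσ₄
  have h₁ : HoldsPerm permA π σ₁ := by
    have key := Cmd.exec_loop_zero_induction (c := iA)
      (p := .assign permA (.reg iA) (.sub (.read objectA (.reg iA)) (.const 1))) hE.size
      (fun m τ => ∀ i : Fin n, i < m → τ permA i = π i)
      (fun i hi => absurd hi (Nat.not_lt_zero _)) ?_
    · exact fun i => key i i.2
    · intro m τ hm hc hf ih i hi
      have hτ : τ objectA = σ objectA := hf objectA (by decide)
      rw [Store.write_of_ne _ _ _ (by decide)]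
      simp only [Cmd.exec_assign, Expr.eval, hc, Store.write_same_apply, hτ]
      split_ifs with him
      · rw [← him, hσ, Nat.add_sub_cancel]
      · exact ih i (by omega)
  have E₁ : Env D σ₁ := hE.exec _ (by decide)
  have E₂ : Env D σ₂ := E₁.exec _ (by decide)
  have E₃ : Env D σ₃ := E₂.exec _ (by decide)
  have E₄ : Env D σ₄ := E₃.exec _ (by decide)
  have h₂ : HoldsPerm candA π σ₂ := fun i =>
    (exec_copy E₁.size (by decide) (by decide) (by decide) i).trans (h₁ i)
  have h₃ : HoldsPerm candA π σ₃ := fun i => by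
    rw [hσ₃, Cmd.exec_apply_of_writes _ (by decide)]; exact h₂ i
  have hsum : σ₄ sumA 0 = ∑ i, weight D i (π i) := by
    rw [hσ₄, Cmd.exec_apply_of_writes _ (by decide)]
    exact exec_computeSum E₂ h₂
  have hlen : σ₄ lenA 0 = Function.minimalPeriod π 0 := exec_computeLen E₃.size h₃
  refine ⟨(E₄.write (by decide) _ _).write (by decide) _ _, fun i => ?_, by simp [hlen],
    by simp [hsum], le_rfl⟩
  have : σ₄ permA = σ₁ permA := by
    rw [hσ₄, Cmd.exec_apply_of_writes _ (by decide), hσ₃,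
      Cmd.exec_apply_of_writes _ (by decide), hσ₂, Cmd.exec_apply_of_writes _ (by decide)]
  simp [this, h₁ i]

theorem exec_outputCycle (hn : σ 0 0 = n) (hσ : HoldsPerm permA π σ) :
    ∀ k < n, outputCycle.exec σ 3 k = (π^[k] 0 : Fin n) := by
  simp only [outputCycle, Cmd.exec_block_cons, Cmd.exec_block_nil]
  set σ' := (Cmd.set curA (.const 0)).exec σ with hσ'
  have hn' : σ' 0 0 = n := by simp [hσ', hn]
  have key := Cmd.exec_loop_zero_induction (c := iA) (p := .block [
    .assign 3 (.reg iA) (.reg curA), .set curA (.read permA (.reg curA))]) hn'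
    (fun m τ => τ curA 0 = (π^[m] 0 : Fin n) ∧ ∀ k < m, τ 3 k = (π^[k] 0 : Fin n))
    (by simp [hσ']) ?_
  · exact key.2
  · rintro m τ hm hc hf ⟨hcur, hout⟩
    have hτ : τ permA = σ permA := by rw [hf permA (by decide)]; simp [hσ']
    refine ⟨?_, fun k hk => ?_⟩
    · rw [Function.iterate_succ_apply', ← hσ]
      simp [hτ, hcur]
    · simp only [Cmd.exec_block_cons, Cmd.exec_block_nil, Cmd.exec_assign, Expr.eval, hc, hcur]
      rw [Store.write_of_ne _ _ _ (by decide), Store.write_of_ne _ _ _ (by decide),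
        Store.write_same_apply]
      split_ifs with hkm
      · rw [hkm]
      · exact hout k (by omega)

/-- On a nonempty digraph, the algorithm answers yes and outputs the cycle of a permutation of
almost maximal, hence maximal, weight that has only one cycle. -/
theorem exec_algorithm (hD : D.IsExtendedSemicomplete P) (hs : D.IsStrong) :
    ∃ π : Perm (Fin n), Function.minimalPeriod π 0 = n ∧
      (∀ ρ : Perm (Fin n), ∑ i, weight D i (ρ i) ≤ ∑ i, weight D i (π i) + n) ∧
      answer (algorithm.exec (inputDigraph D)) = 1 ∧
      OutputsList (algorithm.exec (inputDigraph D)) (cycleList π) := by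
  simp only [algorithm, Cmd.exec_block_cons, Cmd.exec_block_nil]
  have h₁ := isAuction_setup D
  set σ₁ := setup.exec (inputDigraph D)
  obtain ⟨h₂, hall⟩ := exec_auction (D := D) (σ := σ₁) ⟨h₁, .inr (Nat.zero_le _)⟩
  set σ₂ := auction.exec σ₁
  obtain ⟨π₀, hπ₀, hmax⟩ := h₂.2.exists_perm hall
  obtain ⟨π, h₃, hπ⟩ := exec_search hD hs (exec_prepareSearch h₂.1 hπ₀)
  set σ₃ := search.exec (prepareSearch.exec σ₂)
  have hout := exec_outputCycle h₃.env.size h₃.perm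
  have hn : outputCycle.exec σ₃ 0 0 = n := by
    rw [Cmd.exec_apply_of_writes _ (by decide), h₃.env.size]
  have hcond : (Expr.reg 0).eval (outputCycle.exec σ₃) ≠ 0 := by
    simpa [hn] using NeZero.ne n
  refine ⟨π, hπ, fun ρ => (hmax ρ).trans (Nat.add_le_add_right h₃.le_sum n), ?_, ?_⟩ <;>
    rw [Cmd.exec_ite, if_pos hcond]
  · simp [answer]
  · intro i
    have hi : i.val < n := by simpa [cycleList] using i.2
    rw [Cmd.exec_assign, Store.write_of_ne _ _ _ (by decide), hout i hi, List.get_eq_getElem]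
    simp only [cycleList, List.getElem_ofFn]

end RAM

theorem mainTheorem3 :
    ∃ (prog : RAM.Prog) (bound : Polynomial ℕ),
      ∀ (n : ℕ) (D : Digraph (Fin n)) (P : Setoid (Fin n)),
        D.IsExtendedSemicomplete P → D.IsStrong →
        ∃ (τ : RAM.Store) (t : ℕ),
          RAM.Runs prog (RAM.inputDigraph D) τ t ∧
          t ≤ bound.eval n ∧
          ((RAM.answer τ = 1 ∧ ∃ c : List (Fin n), D.IsSpanningGCycle P c) ∨
            (RAM.answer τ = 0 ∧ ¬ ∃ c : List (Fin n), D.IsSpanningGCycle P c)) ∧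
          ((∃ c : List (Fin n), D.IsSpanningGCycle P c) →
            ∃ c : List (Fin n), D.IsSpanningGCycle P c ∧
              (∀ c' : List (Fin n), D.IsSpanningGCycle P c' → D.gLength c' ≤ D.gLength c) ∧
              RAM.OutputsList τ c) := by
  refine ⟨RAM.algorithm.compile, RAM.algorithm.time, fun n D P hD hs => ?_⟩
  have hsize : RAM.inputDigraph D 0 0 = n := by simp [RAM.inputDigraph]
  obtain ⟨t, ht, hrun⟩ := RAM.Cmd.runs_compile (p := RAM.algorithm) (by decide)
    (RAM.inputDigraph D)
  rw [hsize] at ht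
  refine ⟨_, t, hrun, ht, ?_⟩
  rcases Nat.eq_zero_or_pos n with rfl | hpos
  · have hno : ¬ ∃ c : List (Fin 0), D.IsSpanningGCycle P c := by
      rintro ⟨c, hc⟩
      exact hc.1.ne_nil (List.eq_nil_iff_forall_not_mem.2 fun v => v.elim0)
    refine ⟨.inr ⟨?_, hno⟩, fun h => absurd h hno⟩
    set p := RAM.Cmd.block [RAM.setup, RAM.auction, RAM.prepareSearch, RAM.search,
      RAM.outputCycle] with hp
    have hlast : RAM.algorithm.exec (RAM.inputDigraph D) = p.exec (RAM.inputDigraph D) := by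
      have h0 : p.exec (RAM.inputDigraph D) 0 0 = 0 := by
        rw [RAM.Cmd.exec_apply_of_writes _ (by decide), hsize]
      simp only [hp, RAM.Cmd.exec_block_cons, RAM.Cmd.exec_block_nil] at h0
      simp [RAM.algorithm, hp, h0]
    rw [RAM.answer, hlast, RAM.Cmd.exec_apply_of_writes _ (by decide)]
    simp [RAM.inputDigraph]
  · have : NeZero n := ⟨hpos.ne'⟩
    obtain ⟨π, hπ, hmax, hans, hout⟩ := RAM.exec_algorithm hD hs
    have hc := isSpanningGCycle_cycleList hπ (RAM.adj_or_rel_of_sum_weight hD hmax)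
    refine ⟨.inl ⟨hans, _, hc⟩, fun _ => ⟨_, hc, fun c' hc' => ?_, hout⟩⟩
    obtain ⟨ρ, hρ, hlen⟩ := hc'.exists_perm
    rw [hlen, Digraph.gLength_eq_card (rotate_cycleList hπ) hc.1.nodup hc.2]
    exact RAM.card_le_of_sum_weight hD hmax hρ
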